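/- **Setting.** A sender has type $t\in\{h,l\}$, high with probability $p\in(0,1)$; independently the state $s\in\{0,1\}$ equals $1$ with probability $\mu\in[\tfrac12,1)$. In state $s$, type $t$ observes a signal $\ell\in[0,\infty]$ with distribution function $F(\cdot|t,s)$, which has no atoms, has support $[\underline\ell^t,\bar\ell^t]$ with $\underline\ell^t<\bar\ell^t$ (the same in both states), and has a continuous density $f(\cdot|t,s)$ inside the support; signals are labeled as likelihood ratios, $f(\ell|t,1)/f(\ell|t,0)=\ell$. The sender sends a report $m\in\{0,1\}$, and the receiver takes an action $a\in\{0,1\}$ with payoff $1$ if $a=s$ and $0$ otherwise. A market observing $(m,s)$ assigns probability $r(m,s)$ to the high type (by Bayes' rule whenever $(m,s)$ has positive probability), and both sender types maximize the expectation of $r(m,s)$. An *informative equilibrium* is a Bayesian Nash equilibrium in which some report sent with positive probability changes the receiver's belief about the state, with reports labeled so that $r(0,0)>r(1,0)$ and $r(1,1)>r(0,1)$. Let $H_{\mu,F}(\beta|t,s)=F\big(\tfrac{1-\mu}{\mu}\tfrac{\beta}{1-\beta}\,\big|\,t,s\big)$ be the distribution function of type $t$'s belief that the state is $1$. Let $\mathcal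 F$ be the set of experiment profiles $F$ such that (a) $\underline\ell^h<\underline\ell^l$ and $\bar\ell^l<\bar\ell^h$; (b) for each $s$ and each $\ell\in(\underline\ell^l,\bar\ell^l)$, $\frac{f(\ell|l,s)}{F(\ell|l,s)}>\frac{f(\ell|h,s)}{F(\ell|h,s)}$ and $\frac{f(\ell|l,s)}{1-F(\ell|l,s)}>\frac{f(\ell|h,s)}{1-F(\ell|h,s)}$; (c) for some $\mu'\in[\tfrac12,1)$, $\beta^\dagger_1(\mu',F)<\beta^\dagger_0(\mu',F)$, where $\beta^\dagger_s(\mu,F)$ is the belief strictly between the low type's lowest and highest beliefs such that, on the interior of the high type's range of beliefs, $H_{\mu,F}(\cdot|h,s)-H_{\mu,F}(\cdot|l,s)$ is positive below it, zero at it, and negative above it. For a cutoff $\beta$ let $r^*(0,s,\beta)=\frac{pH_{\mu,F}(\beta|h,s)}{pH_{\mu,F}(\beta|h,s)+(1-p)H_{\mu,F}(\beta|l,s)}$ and $r^*(1,s,\beta)=\frac{p(1-H_{\mu,F}(\beta|h,s))}{p(1-H_{\mu,F}(\beta|h,s))+(1-p)(1-H_{\mu,F}(\beta|l,s))}$. The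 threshold $\mu^I_{p,F}$ is the prior $\mu\in(0,1)$ at which $\beta=\tfrac12$ solves $$\beta r^*(0,1,\beta)+(1-\beta)r^*(0,0,\beta)=\beta r^*(1,1,\beta)+(1-\beta)r^*(1,0,\beta).$$ It satisfies $\mu^I_{p,F}<1/(1+\underline\ell^h)$, and for each prior $\mu\in[\tfrac12,1)$, in every informative equilibrium both types report $1$ at beliefs above some cutoff $\beta$ and $0$ at beliefs below it (almost surely), where $\beta>\tfrac12$ if and only if $\mu>\mu^I_{p,F}$. **Theorem.** Let $p\in(0,1)$, and let $(F^k)_{k\ge0}$ be a sequence in $\mathcal F$ along which the low type's experiment is constant and the high type's experiment converges weakly to the perfect experiment $F^*$ (on $[0,\infty]$: unit mass at $0$ in state $0$ and at $\infty$ in state $1$). Then for each $k$ the threshold $\mu^I_{p,F^k}$ exists, is unique and has the properties just listed, and the limit $\mu^I_p:=\lim_{k\to\infty}\mu^I_{p,F^k}$ exists. For each $k$ and each $\mu\in[\tfrac12,1)$ an informative equilibrium exists, and all of them give the receiver the same payoff $U_k(\mu)$. Moreover: 1. For each $\mu\in[\tfrac12,\mu^I_p)$ there exist $K_\mu$ and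 $\varepsilon_\mu>0$ such that for all $k\ge K_\mu$ the payoff $U_k$ is strictly decreasing on $(\mu-\varepsilon_\mu,\mu+\varepsilon_\mu)\cap[\tfrac12,1)$. 2. For each $\mu\in[\tfrac12,1)$ with $\mu>\mu^I_p$ there exist $K_\mu$ and $\varepsilon_\mu>0$ such that for all $k\ge K_\mu$ the payoff $U_k$ is strictly increasing on $(\mu-\varepsilon_\mu,\mu+\varepsilon_\mu)\cap[\tfrac12,1)$. -/

import Mathlib

open MeasureTheory Filter Set
open scoped ENNReal Topology

namespace Cheap

/-- The sender's type. -/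
inductive SenderType where
  | high
  | low

/-- States, reports and actions: all of them are elements of `{0, 1}`. -/
abbrev State := Fin 2

/-- An experiment whose signals `ℓ ∈ [0, ∞]` are labeled by their likelihood ratios. The support of
the signal is the interval `[lo, hi] ⊆ [0, ∞]` in both states, and in state `s` the signal has a
density which is continuous inside the support (so the distribution function is continuously
differentiable there and there are no atoms).

Since `x > 0` inside the support, `ratio` forces both densities to be positive there, so that the
support of each `law s` is all of `[lo, hi]`. -/
structure Experiment where
  lo : ℝ≥0∞
  hi : ℝ≥0∞
  lo_lt_hi : lo < hi
  density : State → ℝ → ℝ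
  density_nonneg : ∀ s x, lo < ENNReal.ofReal x → ENNReal.ofReal x < hi → 0 ≤ density s x
  density_continuousOn : ∀ s,
    ContinuousOn (density s) {x : ℝ | lo < ENNReal.ofReal x ∧ ENNReal.ofReal x < hi}
  ratio : ∀ x, lo < ENNReal.ofReal x → ENNReal.ofReal x < hi → density 1 x / density 0 x = x
  /-- the law of the signal in each state -/
  law : State → ProbabilityMeasure ℝ≥0∞
  law_eq : ∀ s, (law s : Measure ℝ≥0∞) =
    ((volume.restrict {x : ℝ | lo < ENNReal.ofReal x ∧ ENNReal.ofReal x < hi}).withDensity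
      (fun x => ENNReal.ofReal (density s x))).map ENNReal.ofReal

/-- The distribution function `F(ℓ | t, s)` of the signal. -/
noncomputable def Experiment.cdf (E : Experiment) (s : State) (ℓ : ℝ≥0∞) : ℝ :=
  ((E.law s : Measure ℝ≥0∞) (Iic ℓ)).toReal

/-- The perfect experiment `F*`: unit mass at `0` in state `0` and at `∞` in state `1`. -/
noncomputable def perfectLaw (s : State) : ProbabilityMeasure ℝ≥0∞ :=
  diracProba (if s = 1 then ⊤ else 0)

/-- A profile of experiments, one for each sender type. -/
abbrev Profile := SenderType → Experiment

/-- Expectation over the sender's type, which is high with probability `p`. -/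
def typeMean (p : ℝ) (g : SenderType → ℝ) : ℝ := p * g .high + (1 - p) * g .low

/-- The prior probability of state `s`, when state `1` has prior probability `μ`. -/
def prior (μ : ℝ) (s : State) : ℝ := if s = 1 then μ else 1 - μ

/-- The belief that the state is `1` induced by the signal (likelihood ratio) `ℓ`. -/
noncomputable def stateBelief (μ : ℝ) (ℓ : ℝ≥0∞) : ℝ :=
  if ℓ = ⊤ then 1 else μ * ℓ.toReal / (μ * ℓ.toReal + (1 - μ))

/-- The distribution function `H_{μ,F}(β | t, s)` of the sender's state belief. (For `β = 1` the
likelihood ratio below is `∞`, by the conventions of `ℝ≥0∞`.) -/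
noncomputable def beliefCdf (μ : ℝ) (E : Experiment) (s : State) (β : ℝ) : ℝ :=
  E.cdf s (ENNReal.ofReal ((1 - μ) / μ) * (ENNReal.ofReal β / ENNReal.ofReal (1 - β)))

/-- The low type's experiment is noisier than the high type's: the low type's support is strictly
inside the high type's at both ends, and inside the low type's support the low type has the higher
reverse hazard rate and the higher hazard rate, in each state. -/
structure LowNoisier (F : Profile) : Prop where
  lo_lt : (F .high).lo < (F .low).lo
  hi_lt : (F .low).hi < (F .high).hi
  reverse_hazard : ∀ (s : State) (x : ℝ),
    (F .low).lo < ENNReal.ofReal x → ENNReal.ofReal x < (F .low).hi →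
    (F .high).density s x / (F .high).cdf s (ENNReal.ofReal x) <
      (F .low).density s x / (F .low).cdf s (ENNReal.ofReal x)
  hazard : ∀ (s : State) (x : ℝ),
    (F .low).lo < ENNReal.ofReal x → ENNReal.ofReal x < (F .low).hi →
    (F .high).density s x / (1 - (F .high).cdf s (ENNReal.ofReal x)) <
      (F .low).density s x / (1 - (F .low).cdf s (ENNReal.ofReal x))

/-- `b` is the crossing belief `β†_s(μ, F)` in state `s`: it lies strictly between the lowest and
the highest state belief of the low type, and on the high type's range of state beliefs
`H(· | h, s) - H(· | l, s)` is positive below `b`, zero at `b`, and negative above `b`. -/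
structure IsCrossingBelief (μ : ℝ) (F : Profile) (s : State) (b : ℝ) : Prop where
  mem : b ∈ Ioo (stateBelief μ (F .low).lo) (stateBelief μ (F .low).hi)
  pos : ∀ β ∈ Ioo (stateBelief μ (F .high).lo) (stateBelief μ (F .high).hi), β < b →
    beliefCdf μ (F .low) s β < beliefCdf μ (F .high) s β
  zero : beliefCdf μ (F .high) s b = beliefCdf μ (F .low) s b
  neg : ∀ β ∈ Ioo (stateBelief μ (F .high).lo) (stateBelief μ (F .high).hi), b < β →
    beliefCdf μ (F .high) s β < beliefCdf μ (F .low) s β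

/-- The class `𝓕` of experiment profiles: the low type's experiment is noisier, and the crossing
beliefs satisfy `β†_1(μ', F) < β†_0(μ', F)` for some prior `μ' ∈ [1/2, 1)`. -/
def profileClass : Set Profile :=
  {F | LowNoisier F ∧ ∃ μ' ∈ Ico (1 / 2 : ℝ) 1, ∃ b₀ b₁ : ℝ,
    IsCrossingBelief μ' F 0 b₀ ∧ IsCrossingBelief μ' F 1 b₁ ∧ b₁ < b₀}

/-- A kernel from `α` to `{0, 1}`, given by the probability of `1`. It is a strategy of one sender
type for `α = [0, ∞]`, and a strategy of the receiver for `α = {0, 1}`. -/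
structure Strategy (α : Type) [MeasurableSpace α] where
  probOne : α → ℝ
  measurable : Measurable probOne
  mem_Icc : ∀ a, probOne a ∈ Icc (0 : ℝ) 1

/-- The probability of `m` given `a` under a strategy. -/
def Strategy.prob {α : Type} [MeasurableSpace α] (σ : Strategy α) (m : State) (a : α) : ℝ :=
  if m = 1 then σ.probOne a else 1 - σ.probOne a

/-- Probability that report `m` is sent in state `s`, with experiment `E` and strategy `σ`. -/
noncomputable def reportProb (E : Experiment) (σ : Strategy ℝ≥0∞) (m s : State) : ℝ :=
  ∫ ℓ, σ.prob m ℓ ∂(E.law s : Measure ℝ≥0∞)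

/-- Probability, over the sender's type too, that report `m` is sent in state `s`. -/
noncomputable def meanReportProb (p : ℝ) (F : Profile) (σ : SenderType → Strategy ℝ≥0∞)
    (m s : State) : ℝ :=
  typeMean p (fun t => reportProb (F t) (σ t) m s)

/-- Expected reputation of a type with experiment `E` and strategy `σ`, when the market believes
that the sender is a high type with probability `r m s` after report `m` and state `s`. -/
noncomputable def senderPayoff (μ : ℝ) (E : Experiment) (r : State → State → ℝ)
    (σ : Strategy ℝ≥0∞) : ℝ :=
  ∑ s, prior μ s * ∑ m, reportProb E σ m s * r m s

/-- The receiver's expected payoff: the probability that his action equals the state. -/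
noncomputable def receiverPayoff (μ p : ℝ) (F : Profile) (σ : SenderType → Strategy ℝ≥0∞)
    (τ : Strategy State) : ℝ :=
  ∑ s, prior μ s * ∑ m, meanReportProb p F σ m s * τ.prob s m

/-- Bayesian Nash equilibrium, with `r m s` the sender's reputation after report `m` and state
`s`. Reputation follows from Bayes' rule whenever the market's observation has positive
probability. -/
structure IsEquilibrium (μ p : ℝ) (F : Profile) (σ : SenderType → Strategy ℝ≥0∞)
    (τ : Strategy State) (r : State → State → ℝ) : Prop where
  reputation_mem : ∀ m s, r m s ∈ Icc (0 : ℝ) 1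
  bayes : ∀ m s, 0 < meanReportProb p F σ m s →
    r m s = p * reportProb (F .high) (σ .high) m s / meanReportProb p F σ m s
  sender_optimal : ∀ t (σ' : Strategy ℝ≥0∞),
    senderPayoff μ (F t) r σ' ≤ senderPayoff μ (F t) r (σ t)
  receiver_optimal : ∀ τ' : Strategy State,
    receiverPayoff μ p F σ τ' ≤ receiverPayoff μ p F σ τ

/-- Some report is sent with positive probability and moves the receiver's belief that the state
is `1` away from the prior `μ`. -/
def IsInformative (μ p : ℝ) (F : Profile) (σ : SenderType → Strategy ℝ≥0∞) : Prop :=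
  ∃ m, 0 < ∑ s, prior μ s * meanReportProb p F σ m s ∧
    μ * meanReportProb p F σ m 1 / ∑ s, prior μ s * meanReportProb p F σ m s ≠ μ

/-- Informative equilibrium, with reports labeled such that in each state a correct report yields
a strictly higher reputation than an incorrect one. -/
def IsInformativeEquilibrium (μ p : ℝ) (F : Profile) (σ : SenderType → Strategy ℝ≥0∞)
    (τ : Strategy State) : Prop :=
  ∃ r, IsEquilibrium μ p F σ τ r ∧ IsInformative μ p F σ ∧ r 1 0 < r 0 0 ∧ r 0 1 < r 1 1

/-- The receiver's payoffs in the informative equilibria. -/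
def informativePayoffs (μ p : ℝ) (F : Profile) : Set ℝ :=
  {u | ∃ σ τ, IsInformativeEquilibrium μ p F σ τ ∧ u = receiverPayoff μ p F σ τ}

/-- Almost surely, each type reports `1` if her state belief exceeds `β`, and `0` if it is
below `β`. -/
def HasCutoff (μ : ℝ) (F : Profile) (σ : SenderType → Strategy ℝ≥0∞) (β : ℝ) : Prop :=
  ∀ (t : SenderType) (s : State), ∀ᵐ ℓ ∂((F t).law s : Measure ℝ≥0∞),
    (β < stateBelief μ ℓ → (σ t).prob 1 ℓ = 1) ∧ (stateBelief μ ℓ < β → (σ t).prob 0 ℓ = 1)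

/-- The reputation `r*(m, s, β)` if both types use the state-belief cutoff `β`. -/
noncomputable def cutoffReputation (μ p : ℝ) (F : Profile) (m s : State) (β : ℝ) : ℝ :=
  if m = 1 then
    p * (1 - beliefCdf μ (F .high) s β) / typeMean p (fun t => 1 - beliefCdf μ (F t) s β)
  else
    p * beliefCdf μ (F .high) s β / typeMean p (fun t => beliefCdf μ (F t) s β)

/-- If both types use the cutoff `β`, a sender with state belief `β` is indifferent. -/
def IndifferentAt (μ p : ℝ) (F : Profile) (β : ℝ) : Prop :=
  β * cutoffReputation μ p F 0 1 β + (1 - β) * cutoffReputation μ p F 0 0 β =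
    β * cutoffReputation μ p F 1 1 β + (1 - β) * cutoffReputation μ p F 1 0 β

/-- `x` is the threshold `μ^I_{p,F}`: it is the prior in `(0, 1)` at which the cutoff `1/2`
satisfies the indifference condition, it is below `1 / (1 + ℓ)` with `ℓ` the high type's lowest
signal, and for each prior `μ ∈ [1/2, 1)` the cutoff of each informative equilibrium exceeds
`1/2` if and only if `μ > x`. -/
structure IsPriorThreshold (p : ℝ) (F : Profile) (x : ℝ) : Prop where
  pos : 0 < x
  lt_bound : x < 1 / (1 + (F .high).lo.toReal)
  indifferent : IndifferentAt x p F (1 / 2)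
  cutoff_iff : ∀ μ ∈ Ico (1 / 2 : ℝ) 1, ∀ σ τ, IsInformativeEquilibrium μ p F σ τ →
    ∃ β ∈ Ioo (0 : ℝ) 1, HasCutoff μ F σ β ∧ (1 / 2 < β ↔ x < μ)

end Cheap

/-!
Everything is expressed through the likelihood-ratio cutoff `x` instead of the belief cutoff,
because the reputation gaps `D₀(x)`, `D₁(x)` (`reputationGap`: the reputation after report `0`
minus that after report `1`, in state `0` or `1`) and the crossing points `c₁ < c₀` do not depend
on the prior. The gap `D_s` has the sign of the difference between the high and the low type's
distribution functions, and the hazard-rate conditions make it strictly decreasing on the low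
type's support (`LowNoisier.strictAntiOn_reputationGap`).

A sender's gain from report `1` is increasing in her signal, so optimal strategies are almost
surely cutoff strategies (`isRatioCutoff_of_optimal`), and an informative equilibrium at the prior
`μ` amounts to a solution of `μ x D₁(x) + (1 - μ) D₀(x) = 0` with `D₁(x) < 0 < D₀(x)`. Such an `x`
lies between the crossing points, exists by the intermediate value theorem, and is unique and
decreasing in `μ` by monotonicity of the gaps (`HasCrossings.prior_lt_of_ratio_lt`). The threshold
prior is `1 / (1 + x₀)`, where `D₀(x₀) + D₁(x₀) = 0` (`HasCrossings.isPriorThreshold_iff`).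

When the high type becomes perfectly informed, a wrong report reveals the low type, so `x₀`
converges to the point `x` at which the low type's distribution functions satisfy `L₀(x) + L₁(x) =
1` (`tendsto_ratio_threshold`). With `G_s` the mean distribution functions, following the report
yields `V(μ, x) = μ (1 - G₁(x)) + (1 - μ) G₀(x)`, and the receiver's payoff is `max μ (V(μ, x))`.
The direct effect of the prior has the sign of `1 - G₀ - G₁`, which in the limit is that of `1 -
L₀ - L₁`: negative below the limiting threshold, and positive above it. The indirect effect,
through the fall of the cutoff, never opposes it: signals are likelihood ratios, so `V(μ, ·)`
increases while the belief at the cutoff is below `1/2` and decreases while it is above. No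
derivative of the equilibrium cutoff is needed (`payoff_lt_of_low_belief`,
`payoff_lt_of_high_belief`).
-/

namespace Cheap

/-! ### Distribution functions of an experiment -/

namespace Experiment

variable (E : Experiment)

/-- The interior of the support, as a set of real likelihood ratios. -/
def interiorSupport : Set ℝ := {x : ℝ | E.lo < ENNReal.ofReal x ∧ ENNReal.ofReal x < E.hi}

/-- The distribution function of the signal at a real likelihood ratio; it vanishes at negative
arguments. -/
noncomputable def dist (s : State) (x : ℝ) : ℝ := E.cdf s (ENNReal.ofReal x)

/-- The density of the signal, extended by `0` to the real line. -/
noncomputable def extDensity (s : State) : ℝ → ℝ := E.interiorSupport.indicator (E.density s)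

lemma isOpen_interiorSupport : IsOpen E.interiorSupport :=
  isOpen_Ioo.preimage ENNReal.continuous_ofReal

lemma ordConnected_interiorSupport : E.interiorSupport.OrdConnected :=
  ordConnected_Ioo.preimage_mono fun _ _ h => ENNReal.ofReal_le_ofReal h

variable {E}

lemma pos_of_mem {x : ℝ} (hx : x ∈ E.interiorSupport) : 0 < x :=
  ENNReal.ofReal_pos.1 (bot_le.trans_lt hx.1)

lemma density_zero_pos {x : ℝ} (hx : x ∈ E.interiorSupport) : 0 < E.density 0 x := by
  refine lt_of_le_of_ne (E.density_nonneg 0 x hx.1 hx.2) fun h => ?_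
  have := E.ratio x hx.1 hx.2
  rw [← h, div_zero] at this
  exact (pos_of_mem hx).ne this

lemma density_one {x : ℝ} (hx : x ∈ E.interiorSupport) : E.density 1 x = x * E.density 0 x :=
  (div_eq_iff (density_zero_pos hx).ne').1 (E.ratio x hx.1 hx.2)

lemma density_pos (s : State) {x : ℝ} (hx : x ∈ E.interiorSupport) : 0 < E.density s x := by
  fin_cases s
  · exact density_zero_pos hx
  · exact (mul_pos (pos_of_mem hx) (density_zero_pos hx)).trans_eq (density_one hx).symm

lemma extDensity_nonneg (s : State) (x : ℝ) : 0 ≤ E.extDensity s x :=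
  indicator_nonneg (fun _ hx => (density_pos s hx).le) x

lemma extDensity_one (x : ℝ) : E.extDensity 1 x = x * E.extDensity 0 x := by
  by_cases hx : x ∈ E.interiorSupport
  · simp [extDensity, hx, density_one hx]
  · simp [extDensity, hx]

variable (E)

lemma aestronglyMeasurable_density (s : State) :
    AEStronglyMeasurable (E.density s) (volume.restrict E.interiorSupport) :=
  (E.density_continuousOn s).aestronglyMeasurable E.isOpen_interiorSupport.measurableSet

lemma density_nonneg_ae (s : State) :
    0 ≤ᵐ[volume.restrict E.interiorSupport] E.density s :=
  (ae_restrict_iff' E.isOpen_interiorSupport.measurableSet).2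
    (ae_of_all _ fun _ hx => (density_pos s hx).le)

lemma law_apply (s : State) {A : Set ℝ≥0∞} (hA : MeasurableSet A) :
    (E.law s : Measure ℝ≥0∞) A =
      ∫⁻ x in ENNReal.ofReal ⁻¹' A ∩ E.interiorSupport, ENNReal.ofReal (E.density s x) := by
  have hA' : MeasurableSet (ENNReal.ofReal ⁻¹' A) := ENNReal.measurable_ofReal hA
  rw [E.law_eq, Measure.map_apply ENNReal.measurable_ofReal hA, withDensity_apply _ hA',
    Measure.restrict_restrict hA']
  rfl

lemma lintegral_density (s : State) :
    ∫⁻ x in E.interiorSupport, ENNReal.ofReal (E.density s x) = 1 := by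
  have := E.law_apply s MeasurableSet.univ
  rw [preimage_univ, univ_inter, measure_univ] at this
  exact this.symm

lemma integrableOn_density (s : State) : IntegrableOn (E.density s) E.interiorSupport := by
  refine ⟨E.aestronglyMeasurable_density s, ?_⟩
  rw [hasFiniteIntegral_iff_ofReal (E.density_nonneg_ae s), lintegral_density]
  exact ENNReal.one_lt_top

lemma integrable_extDensity (s : State) : Integrable (E.extDensity s) :=
  (integrable_indicator_iff E.isOpen_interiorSupport.measurableSet).2 (E.integrableOn_density s)

lemma integral_extDensity (s : State) : ∫ x, E.extDensity s x = 1 := by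
  rw [extDensity, integral_indicator E.isOpen_interiorSupport.measurableSet,
    integral_eq_lintegral_of_nonneg_ae (E.density_nonneg_ae s)
      (E.aestronglyMeasurable_density s), lintegral_density, ENNReal.toReal_one]

lemma dist_eq_integral (s : State) (x : ℝ) : E.dist s x = ∫ y in Iic x, E.extDensity s y := by
  have hS : ENNReal.ofReal ⁻¹' Iic (ENNReal.ofReal x) ∩ E.interiorSupport
      = Iic x ∩ E.interiorSupport := by
    ext y
    refine and_congr_left fun hy => ?_
    simp only [mem_preimage, mem_Iic, ENNReal.ofReal_le_ofReal_iff']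
    exact or_iff_left (pos_of_mem hy).not_ge
  have hsub := Measure.restrict_mono (μ := volume) (Set.inter_subset_right (s := Iic x)
    (t := E.interiorSupport)) le_rfl
  rw [dist, cdf, law_apply _ _ measurableSet_Iic, hS, extDensity,
    setIntegral_indicator E.isOpen_interiorSupport.measurableSet,
    integral_eq_lintegral_of_nonneg_ae (ae_mono hsub (E.density_nonneg_ae s))
      ((E.aestronglyMeasurable_density s).mono_measure hsub)]

lemma dist_sub (s : State) (x y : ℝ) :
    E.dist s y - E.dist s x = ∫ z in x..y, E.extDensity s z := by
  rw [dist_eq_integral, dist_eq_integral]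
  exact intervalIntegral.integral_Iic_sub_Iic (E.integrable_extDensity s).integrableOn
    (E.integrable_extDensity s).integrableOn

lemma one_sub_dist (s : State) (x : ℝ) :
    1 - E.dist s x = ∫ y in Ioi x, E.extDensity s y := by
  rw [dist_eq_integral, ← E.integral_extDensity s, sub_eq_iff_eq_add', ← compl_Iic]
  exact (integral_add_compl measurableSet_Iic (E.integrable_extDensity s)).symm

lemma dist_nonneg (s : State) (x : ℝ) : 0 ≤ E.dist s x := ENNReal.toReal_nonneg

lemma dist_le_one (s : State) (x : ℝ) : E.dist s x ≤ 1 := by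
  rw [← sub_nonneg, one_sub_dist]
  exact integral_nonneg (E.extDensity_nonneg s)

lemma dist_mono (s : State) : Monotone (E.dist s) := fun x y h => by
  rw [← sub_nonneg, dist_sub]
  exact intervalIntegral.integral_nonneg h fun z _ => E.extDensity_nonneg s z

lemma continuous_dist (s : State) : Continuous (E.dist s) := by
  have h : E.dist s = fun x => E.dist s 0 + ∫ z in (0 : ℝ)..x, E.extDensity s z := by
    ext x
    rw [← dist_sub]
    ring
  rw [h]
  exact continuous_const.add (intervalIntegral.continuous_primitive
    (fun a b => (E.integrable_extDensity s).intervalIntegrable) 0)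

variable {E}

lemma hasDerivAt_dist (s : State) {x : ℝ} (hx : x ∈ E.interiorSupport) :
    HasDerivAt (E.dist s) (E.density s x) x := by
  have h : E.dist s = fun x => E.dist s 0 + ∫ z in (0 : ℝ)..x, E.extDensity s z := by
    ext x
    rw [← dist_sub]
    ring
  have hn : E.interiorSupport ∈ 𝓝 x := E.isOpen_interiorSupport.mem_nhds hx
  have he : E.extDensity s =ᶠ[𝓝 x] E.density s :=
    Filter.mem_of_superset hn fun y hy => by simp [extDensity, hy]
  have hc : ContinuousAt (E.extDensity s) x :=
    ((E.density_continuousOn s).continuousAt hn).congr he.symm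
  have := intervalIntegral.integral_hasDerivAt_right (a := 0)
    ((E.integrable_extDensity s).intervalIntegrable)
    ((E.integrable_extDensity s).aestronglyMeasurable.stronglyMeasurableAtFilter) hc
  rw [he.eq_of_nhds] at this
  rw [h]
  exact this.const_add _

lemma strictMonoOn_dist (s : State) : StrictMonoOn (E.dist s) E.interiorSupport :=
  strictMonoOn_of_deriv_pos E.ordConnected_interiorSupport.convex
    (E.continuous_dist s).continuousOn fun x hx => by
      rw [(hasDerivAt_dist s (interior_subset hx)).deriv]
      exact density_pos s (interior_subset hx)

lemma exists_lt_mem {x : ℝ} (hx : x ∈ E.interiorSupport) : ∃ y < x, y ∈ E.interiorSupport :=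
  ((eventually_nhdsWithin_of_forall fun _ h => h : ∀ᶠ y in 𝓝[<] x, y < x).and
    (nhdsWithin_le_nhds (E.isOpen_interiorSupport.mem_nhds hx))).exists

lemma exists_gt_mem {x : ℝ} (hx : x ∈ E.interiorSupport) : ∃ y > x, y ∈ E.interiorSupport :=
  ((eventually_nhdsWithin_of_forall fun _ h => h : ∀ᶠ y in 𝓝[>] x, x < y).and
    (nhdsWithin_le_nhds (E.isOpen_interiorSupport.mem_nhds hx))).exists

lemma dist_pos (s : State) {x : ℝ} (hx : x ∈ E.interiorSupport) : 0 < E.dist s x := by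
  obtain ⟨y, hyx, hy⟩ := exists_lt_mem hx
  exact (E.dist_nonneg s y).trans_lt (strictMonoOn_dist s hy hx hyx)

lemma dist_lt_one (s : State) {x : ℝ} (hx : x ∈ E.interiorSupport) : E.dist s x < 1 := by
  obtain ⟨y, hyx, hy⟩ := exists_gt_mem hx
  exact (strictMonoOn_dist s hx hy hyx).trans_le (E.dist_le_one s y)

lemma dist_eq_zero (s : State) {x : ℝ} (hx : ENNReal.ofReal x ≤ E.lo) : E.dist s x = 0 := by
  rw [dist_eq_integral]
  refine setIntegral_eq_zero_of_forall_eq_zero fun y hy => indicator_of_notMem (fun h => ?_) _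
  exact absurd (h.1.trans_le ((ENNReal.ofReal_le_ofReal hy).trans hx)) (lt_irrefl _)

lemma dist_eq_one (s : State) {x : ℝ} (hx : E.hi ≤ ENNReal.ofReal x) : E.dist s x = 1 := by
  symm
  rw [← sub_eq_zero, one_sub_dist]
  refine setIntegral_eq_zero_of_forall_eq_zero fun y hy => indicator_of_notMem (fun h => ?_) _
  exact absurd ((hx.trans (ENNReal.ofReal_le_ofReal (le_of_lt hy))).trans_lt h.2) (lt_irrefl _)

variable (E)

/-- As signals are likelihood ratios, the mass between `x` and `y` in state `1` is between `x`
times and `y` times the mass in state `0`. -/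
lemma dist_one_sub_mem {x y : ℝ} (h : x ≤ y) :
    x * (E.dist 0 y - E.dist 0 x) ≤ E.dist 1 y - E.dist 1 x ∧
      E.dist 1 y - E.dist 1 x ≤ y * (E.dist 0 y - E.dist 0 x) := by
  have hi : ∀ s, IntervalIntegrable (E.extDensity s) volume x y :=
    fun s => (E.integrable_extDensity s).intervalIntegrable
  rw [dist_sub, dist_sub, ← intervalIntegral.integral_const_mul,
    ← intervalIntegral.integral_const_mul]
  constructor
  · refine intervalIntegral.integral_mono_on h ((hi 0).const_mul x) (hi 1) fun z hz => ?_
    rw [extDensity_one]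
    exact mul_le_mul_of_nonneg_right hz.1 (E.extDensity_nonneg 0 z)
  · refine intervalIntegral.integral_mono_on h (hi 1) ((hi 0).const_mul y) fun z hz => ?_
    rw [extDensity_one]
    exact mul_le_mul_of_nonneg_right hz.2 (E.extDensity_nonneg 0 z)

lemma dist_one_le_mul {x : ℝ} (hx : 0 ≤ x) : E.dist 1 x ≤ x * E.dist 0 x := by
  have := (E.dist_one_sub_mem hx).2
  rwa [dist_eq_zero (x := 0) 0 (by simp), dist_eq_zero (x := 0) 1 (by simp), sub_zero,
    sub_zero] at this

lemma mul_one_sub_dist_le (x : ℝ) : x * (1 - E.dist 0 x) ≤ 1 - E.dist 1 x := by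
  rw [one_sub_dist, one_sub_dist, ← integral_const_mul]
  refine setIntegral_mono_on ((E.integrable_extDensity 0).const_mul x).integrableOn
    (E.integrable_extDensity 1).integrableOn measurableSet_Ioi fun z hz => ?_
  rw [extDensity_one]
  exact mul_le_mul_of_nonneg_right (le_of_lt hz) (E.extDensity_nonneg 0 z)

/-- The signal is larger in state `1`, in the sense of first-order stochastic dominance. -/
lemma dist_one_le (x : ℝ) : E.dist 1 x ≤ E.dist 0 x := by
  rcases le_total x 0 with h | h
  · rw [dist_eq_zero (x := x) 0 (by simp [ENNReal.ofReal_of_nonpos h]),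
      dist_eq_zero (x := x) 1 (by simp [ENNReal.ofReal_of_nonpos h])]
  have h0 := E.dist_nonneg 0 x
  have h1 := E.dist_le_one 0 x
  have h2 := E.dist_one_le_mul h
  have h3 := E.mul_one_sub_dist_le x
  rcases le_total x 1 with h' | h' <;> nlinarith

variable {E}

lemma dist_one_lt {x : ℝ} (hx : x ∈ E.interiorSupport) : E.dist 1 x < E.dist 0 x := by
  have h0 := dist_pos 0 hx
  have h1 := dist_lt_one 0 hx
  have h3 := E.mul_one_sub_dist_le x
  rcases le_or_gt x 1 with h' | h'
  · obtain ⟨y, hyx, hy⟩ := exists_lt_mem hx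
    have h4 := (E.dist_one_sub_mem hyx.le).2
    have h5 := E.dist_one_le_mul (pos_of_mem hy).le
    have h6 := dist_pos 0 hy
    nlinarith [mul_pos (sub_pos.2 hyx) h6]
  · nlinarith

end Experiment

/-! ### Expectations under the law of the signal -/

namespace Experiment

variable (E : Experiment)

lemma integral_law (s : State) {g : ℝ≥0∞ → ℝ} (hg : Measurable g) :
    ∫ ℓ, g ℓ ∂(E.law s : Measure ℝ≥0∞) =
      ∫ x in E.interiorSupport, E.density s x * g (ENNReal.ofReal x) := by
  rw [E.law_eq, integral_map ENNReal.measurable_ofReal.aemeasurable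
    hg.stronglyMeasurable.aestronglyMeasurable]
  refine (integral_withDensity_eq_integral_toReal_smul₀
    (E.aestronglyMeasurable_density s).aemeasurable.ennreal_ofReal
    (ae_of_all _ fun _ => ENNReal.ofReal_lt_top) _).trans ?_
  refine setIntegral_congr_fun E.isOpen_interiorSupport.measurableSet fun x hx => ?_
  simp only [ENNReal.toReal_ofReal (density_pos s hx).le, smul_eq_mul]

lemma ae_law (s : State) {P : ℝ≥0∞ → Prop} (hP : MeasurableSet {ℓ | P ℓ})
    (h : ∀ᵐ x ∂(volume.restrict E.interiorSupport), P (ENNReal.ofReal x)) :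
    ∀ᵐ ℓ ∂(E.law s : Measure ℝ≥0∞), P ℓ := by
  rw [E.law_eq, ae_map_iff ENNReal.measurable_ofReal.aemeasurable hP]
  exact (withDensity_absolutelyContinuous _ _).ae_le h

lemma integrableOn_density_mul (s : State) {g : ℝ≥0∞ → ℝ} (hg : Measurable g)
    (hb : ∀ ℓ, |g ℓ| ≤ 1) :
    IntegrableOn (fun x => E.density s x * g (ENNReal.ofReal x)) E.interiorSupport :=
  (E.integrableOn_density s).mul_bdd (c := 1)
    (hg.comp ENNReal.measurable_ofReal).aestronglyMeasurable (ae_of_all _ fun _ => hb _)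

end Experiment

/-! ### Reports and cutoff strategies -/

lemma Strategy.abs_probOne_le {α : Type} [MeasurableSpace α] (σ : Strategy α) (a : α) :
    |σ.probOne a| ≤ 1 := by
  rw [abs_of_nonneg (σ.mem_Icc a).1]
  exact (σ.mem_Icc a).2

lemma Strategy.integrable_probOne (E : Experiment) (s : State) (σ : Strategy ℝ≥0∞) :
    Integrable σ.probOne (E.law s : Measure ℝ≥0∞) :=
  Integrable.of_bound σ.measurable.aestronglyMeasurable 1 (ae_of_all _ σ.abs_probOne_le)

lemma reportProb_one (E : Experiment) (σ : Strategy ℝ≥0∞) (s : State) :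
    reportProb E σ 1 s = ∫ ℓ, σ.probOne ℓ ∂(E.law s : Measure ℝ≥0∞) := by
  simp [reportProb, Strategy.prob]

lemma reportProb_zero (E : Experiment) (σ : Strategy ℝ≥0∞) (s : State) :
    reportProb E σ 0 s = 1 - reportProb E σ 1 s := by
  rw [reportProb_one]
  simp only [reportProb, Strategy.prob, zero_ne_one, if_false]
  rw [integral_sub (integrable_const _) (σ.integrable_probOne E s)]
  simp

/-- The strategy that reports `1` exactly at signals (likelihood ratios) above `c`. -/
noncomputable def cutoffStrategy (c : ℝ) : Strategy ℝ≥0∞ where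
  probOne := (Ioi (ENNReal.ofReal c)).indicator 1
  measurable := measurable_one.indicator measurableSet_Ioi
  mem_Icc ℓ := by
    by_cases h : ℓ ∈ Ioi (ENNReal.ofReal c) <;> simp [h]

/-- Almost surely in each state, `σ` reports `1` at finite signals above `c` and `0` at signals
below `c`. -/
def IsRatioCutoff (E : Experiment) (σ : Strategy ℝ≥0∞) (c : ℝ) : Prop :=
  ∀ s : State, ∀ᵐ ℓ ∂(E.law s : Measure ℝ≥0∞), ℓ ≠ ⊤ ∧
    (ENNReal.ofReal c < ℓ → σ.probOne ℓ = 1) ∧ (ℓ < ENNReal.ofReal c → σ.probOne ℓ = 0)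

lemma isRatioCutoff_of_ae {E : Experiment} {σ : Strategy ℝ≥0∞} {c : ℝ}
    (h : ∀ᵐ x ∂(volume.restrict E.interiorSupport),
      (c < x → σ.probOne (ENNReal.ofReal x) = 1) ∧ (x < c → σ.probOne (ENNReal.ofReal x) = 0)) :
    IsRatioCutoff E σ c := by
  intro s
  have m1 := σ.measurable (measurableSet_singleton 1)
  have m0 := σ.measurable (measurableSet_singleton 0)
  refine E.ae_law s ?_ ?_
  · exact (measurableSet_singleton ⊤).compl.inter
      ((measurableSet_Ioi.himp m1).inter (measurableSet_Iio.himp m0))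
  · filter_upwards [h] with x hx
    refine ⟨ENNReal.ofReal_ne_top, fun h => hx.1 ?_, fun h => hx.2 ?_⟩
    · exact ((ENNReal.ofReal_lt_ofReal_iff').1 h).1
    · exact ((ENNReal.ofReal_lt_ofReal_iff').1 h).1

lemma isRatioCutoff_cutoffStrategy (E : Experiment) {c : ℝ} (hc : 0 < c) :
    IsRatioCutoff E (cutoffStrategy c) c := by
  refine isRatioCutoff_of_ae (ae_of_all _ fun x => ⟨fun h => ?_, fun h => ?_⟩)
  · exact indicator_of_mem (mem_Ioi.2 ((ENNReal.ofReal_lt_ofReal_iff (hc.trans h)).2 h)) _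
  · exact indicator_of_notMem (notMem_Ioi.2 (ENNReal.ofReal_le_ofReal h.le)) _

lemma IsRatioCutoff.reportProb_one {E : Experiment} {σ : Strategy ℝ≥0∞} {c : ℝ}
    (h : IsRatioCutoff E σ c) (s : State) : reportProb E σ 1 s = 1 - E.dist s c := by
  have hne : ∀ᵐ ℓ ∂(E.law s : Measure ℝ≥0∞), ℓ ≠ ENNReal.ofReal c := by
    rw [ae_iff]
    simp only [not_not, ofPred_eq_eq_singleton]
    rw [E.law_apply s (measurableSet_singleton _)]
    rcases le_or_gt c 0 with hc | hc
    · convert setLIntegral_empty _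
      ext x
      simp only [ENNReal.ofReal_of_nonpos hc, mem_inter_iff, mem_preimage, mem_singleton_iff,
        ENNReal.ofReal_eq_zero, mem_empty_iff_false, iff_false, not_and]
      exact fun hx hx' => (Experiment.pos_of_mem hx').not_ge hx
    · refine setLIntegral_measure_zero _ _ (measure_mono_null (t := {c}) ?_ (by simp))
      rintro x ⟨hx, hx'⟩
      exact (ENNReal.ofReal_eq_ofReal_iff (Experiment.pos_of_mem hx').le hc.le).1 hx
  have : σ.probOne =ᵐ[(E.law s : Measure ℝ≥0∞)] (Ioi (ENNReal.ofReal c)).indicator 1 := by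
    filter_upwards [h s, hne] with ℓ hℓ hne
    rcases lt_or_gt_of_ne hne with h' | h'
    · rw [hℓ.2.2 h', indicator_of_notMem (notMem_Ioi.2 h'.le)]
    · rw [hℓ.2.1 h', indicator_of_mem (mem_Ioi.2 h'), Pi.one_apply]
  rw [Cheap.reportProb_one, integral_congr_ae this, integral_indicator_one measurableSet_Ioi,
    ← compl_Iic, probReal_compl_eq_one_sub measurableSet_Iic]
  rfl

lemma IsRatioCutoff.reportProb_zero {E : Experiment} {σ : Strategy ℝ≥0∞} {c : ℝ}
    (h : IsRatioCutoff E σ c) (s : State) : reportProb E σ 0 s = E.dist s c := by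
  rw [Cheap.reportProb_zero, h.reportProb_one, sub_sub_cancel]

/-! ### Optimal reporting -/

lemma senderPayoff_eq (μ : ℝ) (E : Experiment) (r : State → State → ℝ) (σ : Strategy ℝ≥0∞) :
    senderPayoff μ E r σ = μ * r 0 1 + (1 - μ) * r 0 0 +
      ∫ x in E.interiorSupport, E.density 0 x * σ.probOne (ENNReal.ofReal x) *
        (μ * (r 1 1 - r 0 1) * x - (1 - μ) * (r 0 0 - r 1 0)) := by
  have h0 : reportProb E σ 1 0 = _ := (reportProb_one E σ 0).trans (E.integral_law 0 σ.measurable)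
  have h1 : reportProb E σ 1 1 = _ := (reportProb_one E σ 1).trans (E.integral_law 1 σ.measurable)
  have i0 := E.integrableOn_density_mul 0 σ.measurable σ.abs_probOne_le
  have i1 := E.integrableOn_density_mul 1 σ.measurable σ.abs_probOne_le
  have key : ∫ x in E.interiorSupport, E.density 0 x * σ.probOne (ENNReal.ofReal x) *
        (μ * (r 1 1 - r 0 1) * x - (1 - μ) * (r 0 0 - r 1 0)) =
      reportProb E σ 1 1 * (μ * (r 1 1 - r 0 1)) -
        reportProb E σ 1 0 * ((1 - μ) * (r 0 0 - r 1 0)) := by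
    rw [h0, h1, ← integral_mul_const, ← integral_mul_const, ← integral_sub
      (i1.mul_const _) (i0.mul_const _)]
    refine setIntegral_congr_fun E.isOpen_interiorSupport.measurableSet fun x hx => ?_
    simp only [Experiment.density_one hx]
    ring
  rw [key]
  simp only [senderPayoff, Fin.sum_univ_two, prior, reportProb_zero, zero_ne_one, if_false,
    if_true]
  ring

/-- The gain from switching to the cutoff at which the sender is indifferent is the integral of a
nonnegative function, which vanishes only where the two strategies agree. -/
lemma senderPayoff_cutoff_sub {μ c : ℝ} (E : Experiment) {r : State → State → ℝ}
    (hc : μ * (r 1 1 - r 0 1) * c = (1 - μ) * (r 0 0 - r 1 0)) (σ : Strategy ℝ≥0∞) :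
    let g := fun x => E.density 0 x * ((cutoffStrategy c).probOne (ENNReal.ofReal x) -
        σ.probOne (ENNReal.ofReal x)) * (μ * (r 1 1 - r 0 1) * (x - c))
    IntegrableOn g E.interiorSupport ∧
    senderPayoff μ E r (cutoffStrategy c) - senderPayoff μ E r σ =
      ∫ x in E.interiorSupport, g x := by
  intro g
  have i : ∀ τ : Strategy ℝ≥0∞, IntegrableOn (fun x => E.density 0 x *
      τ.probOne (ENNReal.ofReal x) * (μ * (r 1 1 - r 0 1) * x - (1 - μ) * (r 0 0 - r 1 0)))
      E.interiorSupport := by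
    intro τ
    refine IntegrableOn.congr_fun (((E.integrableOn_density_mul 1 τ.measurable τ.abs_probOne_le).mul_const
      (μ * (r 1 1 - r 0 1))).sub ((E.integrableOn_density_mul 0 τ.measurable
      τ.abs_probOne_le).mul_const ((1 - μ) * (r 0 0 - r 1 0)))) (fun x hx => ?_)
      E.isOpen_interiorSupport.measurableSet
    simp only [Experiment.density_one hx, Pi.sub_apply]
    ring
  have hg : g = fun x => E.density 0 x * (cutoffStrategy c).probOne (ENNReal.ofReal x) *
      (μ * (r 1 1 - r 0 1) * x - (1 - μ) * (r 0 0 - r 1 0)) - E.density 0 x *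
      σ.probOne (ENNReal.ofReal x) * (μ * (r 1 1 - r 0 1) * x - (1 - μ) * (r 0 0 - r 1 0)) := by
    ext x
    simp only [g, ← hc]
    ring
  rw [hg, senderPayoff_eq, senderPayoff_eq, integral_sub (i _) (i _)]
  exact ⟨(i _).sub (i _), by ring⟩

lemma cutoff_gain_nonneg {μ c : ℝ} (E : Experiment) {A : ℝ} (hμ : 0 < μ) (hA : 0 < A)
    (hc : 0 < c) (σ : Strategy ℝ≥0∞) {x : ℝ} (hx : x ∈ E.interiorSupport) :
    0 ≤ E.density 0 x * ((cutoffStrategy c).probOne (ENNReal.ofReal x) -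
        σ.probOne (ENNReal.ofReal x)) * (μ * A * (x - c)) := by
  have hd := (Experiment.density_zero_pos hx).le
  have hσ := σ.mem_Icc (ENNReal.ofReal x)
  rcases le_or_gt x c with h | h
  · have : (cutoffStrategy c).probOne (ENNReal.ofReal x) = 0 :=
      indicator_of_notMem (notMem_Ioi.2 (ENNReal.ofReal_le_ofReal h)) _
    rw [this]
    exact mul_nonneg_of_nonpos_of_nonpos
      (mul_nonpos_of_nonneg_of_nonpos hd (by linarith [hσ.1]))
      (mul_nonpos_of_nonneg_of_nonpos (mul_pos hμ hA).le (sub_nonpos.2 h))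
  · have : (cutoffStrategy c).probOne (ENNReal.ofReal x) = 1 :=
      indicator_of_mem (mem_Ioi.2 ((ENNReal.ofReal_lt_ofReal_iff (hc.trans h)).2 h)) _
    rw [this]
    exact mul_nonneg (mul_nonneg hd (by linarith [hσ.2]))
      (mul_nonneg (mul_pos hμ hA).le (sub_nonneg.2 h.le))

lemma senderPayoff_le_cutoff {μ c : ℝ} (E : Experiment) {r : State → State → ℝ} (hμ : 0 < μ)
    (hA : 0 < r 1 1 - r 0 1) (hc0 : 0 < c)
    (hc : μ * (r 1 1 - r 0 1) * c = (1 - μ) * (r 0 0 - r 1 0)) (σ : Strategy ℝ≥0∞) :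
    senderPayoff μ E r σ ≤ senderPayoff μ E r (cutoffStrategy c) := by
  rw [← sub_nonneg, (senderPayoff_cutoff_sub E hc σ).2]
  exact setIntegral_nonneg E.isOpen_interiorSupport.measurableSet fun x hx =>
    cutoff_gain_nonneg E hμ hA hc0 σ hx

/-- A strategy that is as good as the cutoff strategy at the indifferent signal agrees with it almost
surely, as every deviation on a set of positive probability is costly. -/
lemma isRatioCutoff_of_optimal {μ c : ℝ} {E : Experiment} {r : State → State → ℝ} (hμ : 0 < μ)
    (hA : 0 < r 1 1 - r 0 1) (hc0 : 0 < c)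
    (hc : μ * (r 1 1 - r 0 1) * c = (1 - μ) * (r 0 0 - r 1 0)) {σ : Strategy ℝ≥0∞}
    (hσ : senderPayoff μ E r (cutoffStrategy c) ≤ senderPayoff μ E r σ) :
    IsRatioCutoff E σ c := by
  obtain ⟨hi, he⟩ := senderPayoff_cutoff_sub E hc σ
  have hS := E.isOpen_interiorSupport.measurableSet
  have hn := (ae_restrict_iff' hS).2 (ae_of_all volume fun x hx =>
    cutoff_gain_nonneg E hμ hA hc0 σ hx)
  have hz := (integral_eq_zero_iff_of_nonneg_ae hn hi).1
    (le_antisymm (he ▸ sub_nonpos.2 hσ) (integral_nonneg_of_ae hn))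
  refine isRatioCutoff_of_ae ?_
  filter_upwards [hz, ae_restrict_mem hS] with x hx hxS
  have hd := (Experiment.density_zero_pos hxS).ne'
  have hx' : ∀ h : x ≠ c, σ.probOne (ENNReal.ofReal x) =
      (cutoffStrategy c).probOne (ENNReal.ofReal x) := by
    intro h
    simp only [Pi.zero_apply, mul_eq_zero, hd, false_or, hμ.ne', hA.ne', sub_ne_zero.2 h,
      or_false] at hx
    exact (sub_eq_zero.1 hx).symm
  refine ⟨fun h => ?_, fun h => ?_⟩
  · rw [hx' h.ne']
    exact indicator_of_mem (mem_Ioi.2 ((ENNReal.ofReal_lt_ofReal_iff (hc0.trans h)).2 h)) _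
  · rw [hx' h.ne]
    exact indicator_of_notMem (notMem_Ioi.2 (ENNReal.ofReal_le_ofReal h.le)) _

/-! ### Beliefs and likelihood ratios -/

lemma stateBelief_ofReal (μ : ℝ) {x : ℝ} (hx : 0 ≤ x) :
    stateBelief μ (ENNReal.ofReal x) = μ * x / (μ * x + (1 - μ)) := by
  simp [stateBelief, hx]

lemma strictMono_stateBelief {μ : ℝ} (hμ : μ ∈ Ioo (0 : ℝ) 1) : StrictMono (stateBelief μ) := by
  have h0 := hμ.1
  have h1 := sub_pos.2 hμ.2
  intro a b hab
  have ha := hab.ne_top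
  simp only [stateBelief, ha, if_false]
  have ha0 : 0 ≤ a.toReal := ENNReal.toReal_nonneg
  split_ifs with hb
  · rw [div_lt_one (by positivity)]
    linarith
  · have h := (ENNReal.toReal_lt_toReal ha hb).2 hab
    rw [div_lt_div_iff₀ (by positivity) (by positivity)]
    nlinarith [mul_pos h0 h1]

lemma exists_ratio_eq {μ β : ℝ} (hμ : μ ∈ Ioo (0 : ℝ) 1) (hβ : β ∈ Ioo (0 : ℝ) 1) :
    ∃ x > 0, β = stateBelief μ (ENNReal.ofReal x) := by
  have h0 := hμ.1
  have h1 := sub_pos.2 hμ.2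
  have h2 := hβ.1
  have h3 := sub_pos.2 hβ.2
  have hx : 0 < (1 - μ) / μ * (β / (1 - β)) := by positivity
  refine ⟨_, hx, ?_⟩
  rw [stateBelief_ofReal _ hx.le]
  have : μ * ((1 - μ) / μ * (β / (1 - β))) = (1 - μ) * β / (1 - β) := by field_simp
  rw [this]
  field_simp
  ring

lemma stateBelief_mem {μ x : ℝ} (hμ : μ ∈ Ioo (0 : ℝ) 1) (hx : 0 < x) :
    stateBelief μ (ENNReal.ofReal x) ∈ Ioo (0 : ℝ) 1 := by
  have h0 := hμ.1
  have h1 := sub_pos.2 hμ.2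
  rw [stateBelief_ofReal _ hx.le]
  refine ⟨by positivity, ?_⟩
  rw [div_lt_one (by positivity)]
  linarith

lemma stateBelief_mem_Icc {μ : ℝ} (hμ : μ ∈ Ioo (0 : ℝ) 1) (ℓ : ℝ≥0∞) :
    stateBelief μ ℓ ∈ Icc (0 : ℝ) 1 := by
  have hm := (strictMono_stateBelief hμ).monotone
  have h0 : stateBelief μ 0 = 0 := by simp [stateBelief]
  have h1 : stateBelief μ ⊤ = 1 := by simp [stateBelief]
  exact ⟨h0 ▸ hm bot_le, h1 ▸ hm le_top⟩

lemma half_lt_stateBelief_iff {μ x : ℝ} (hμ : μ ∈ Ioo (0 : ℝ) 1) (hx : 0 < x) :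
    1 / 2 < stateBelief μ (ENNReal.ofReal x) ↔ 1 - μ < μ * x := by
  have h0 := hμ.1
  have h1 := sub_pos.2 hμ.2
  rw [stateBelief_ofReal _ hx.le, div_lt_div_iff₀ two_pos (by positivity)]
  constructor <;> intro h <;> linarith

lemma beliefCdf_eq (μ : ℝ) {β : ℝ} (hβ : β ∈ Ioo (0 : ℝ) 1) (hμ : μ ∈ Ioo (0 : ℝ) 1)
    (E : Experiment) (s : State) :
    beliefCdf μ E s β = E.dist s ((1 - μ) / μ * (β / (1 - β))) := by
  rw [beliefCdf, Experiment.dist, ENNReal.ofReal_mul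
    (div_nonneg (sub_nonneg.2 hμ.2.le) hμ.1.le), ENNReal.ofReal_div_of_pos (sub_pos.2 hβ.2)]

lemma beliefCdf_stateBelief {μ x : ℝ} (hμ : μ ∈ Ioo (0 : ℝ) 1) (hx : 0 < x) (E : Experiment)
    (s : State) : beliefCdf μ E s (stateBelief μ (ENNReal.ofReal x)) = E.dist s x := by
  have h0 := hμ.1
  have h1 := sub_pos.2 hμ.2
  rw [beliefCdf_eq μ (stateBelief_mem hμ hx) hμ, stateBelief_ofReal _ hx.le]
  congr 1
  have h2 : μ * x + (1 - μ) ≠ 0 := by positivity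
  have h3 : 1 - μ * x / (μ * x + (1 - μ)) = (1 - μ) / (μ * x + (1 - μ)) := by
    field_simp
    ring
  rw [h3]
  field_simp

/-! ### Reputation -/

/-- The probability of the high type, by Bayes' rule, given an event that has probability `h` for
the high type and `l` for the low type. -/
noncomputable def posterior (p h l : ℝ) : ℝ := p * h / (p * h + (1 - p) * l)

lemma posterior_self {p h : ℝ} (hh : 0 < h) : posterior p h h = p := by
  rw [posterior, ← add_mul, add_sub_cancel, one_mul, mul_div_cancel_right₀ _ hh.ne']

section posterior

variable {p h l h' l' : ℝ} (hp : p ∈ Ioo (0 : ℝ) 1)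

include hp

lemma posterior_denom_pos (hh : 0 ≤ h) (hl : 0 ≤ l) (hhl : 0 < h + l) :
    0 < p * h + (1 - p) * l := by
  have h0 := hp.1
  have h1 := sub_pos.2 hp.2
  rcases hh.eq_or_lt with rfl | hh
  · rw [zero_add] at hhl
    positivity
  · positivity

lemma posterior_lt_posterior (hh : 0 ≤ h) (hl : 0 ≤ l) (hhl : 0 < h + l) (hh' : 0 ≤ h')
    (hl' : 0 ≤ l') (hhl' : 0 < h' + l') (hlt : h' * l < h * l') :
    posterior p h' l' < posterior p h l := by
  rw [posterior, posterior, div_lt_div_iff₀ (posterior_denom_pos hp hh' hl' hhl')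
    (posterior_denom_pos hp hh hl hhl)]
  nlinarith [mul_pos (mul_pos hp.1 (sub_pos.2 hp.2)) (sub_pos.2 hlt)]

lemma lt_posterior (hl : 0 ≤ l) (hlt : l < h) : p < posterior p h l := by
  conv_lhs => rw [← posterior_self (p := p) one_pos]
  exact posterior_lt_posterior hp (by linarith) hl (by linarith) one_pos.le one_pos.le
    (by norm_num) (by linarith)

lemma posterior_lt (hh : 0 ≤ h) (hlt : h < l) : posterior p h l < p := by
  conv_rhs => rw [← posterior_self (p := p) one_pos]
  exact posterior_lt_posterior hp one_pos.le one_pos.le (by norm_num) hh (by linarith)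
    (by linarith) (by linarith)

lemma posterior_mem (hh : 0 ≤ h) (hl : 0 ≤ l) : posterior p h l ∈ Icc (0 : ℝ) 1 := by
  have h1 := mul_nonneg hp.1.le hh
  have h2 := mul_nonneg (sub_pos.2 hp.2).le hl
  exact ⟨div_nonneg h1 (add_nonneg h1 h2), div_le_one_of_le₀ (by linarith) (add_nonneg h1 h2)⟩

end posterior

/-- The gain in reputation in state `s` from report `0` rather than report `1`, if both types use
the likelihood-ratio cutoff `x`. -/
noncomputable def reputationGap (p : ℝ) (F : Profile) (s : State) (x : ℝ) : ℝ :=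
  posterior p ((F .high).dist s x) ((F .low).dist s x) -
    posterior p (1 - (F .high).dist s x) (1 - (F .low).dist s x)

lemma reputationGap_eq_zero {p x : ℝ} {F : Profile} {s : State}
    (hx : x ∈ (F .high).interiorSupport)
    (h : (F .high).dist s x = (F .low).dist s x) : reputationGap p F s x = 0 := by
  rw [reputationGap, ← h, posterior_self (Experiment.dist_pos s hx),
    posterior_self (sub_pos.2 (Experiment.dist_lt_one s hx)), sub_self]

section gap

variable {p : ℝ} {F : Profile} {s : State} {x : ℝ} (hp : p ∈ Ioo (0 : ℝ) 1)

include hp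

lemma reputationGap_pos (h : (F .low).dist s x < (F .high).dist s x) :
    0 < reputationGap p F s x :=
  sub_pos.2 ((posterior_lt hp (sub_nonneg.2 ((F .high).dist_le_one s x)) (by linarith)).trans
    (lt_posterior hp ((F .low).dist_nonneg s x) h))

lemma reputationGap_neg (h : (F .high).dist s x < (F .low).dist s x) :
    reputationGap p F s x < 0 :=
  sub_neg.2 ((posterior_lt hp ((F .high).dist_nonneg s x) h).trans
    (lt_posterior hp (sub_nonneg.2 ((F .low).dist_le_one s x)) (by linarith)))

lemma continuousOn_reputationGap (s : State) :
    ContinuousOn (reputationGap p F s) (F .high).interiorSupport := by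
  have hH := ((F .high).continuous_dist s)
  have hL := ((F .low).continuous_dist s)
  have c1 := continuous_const (y := (1 : ℝ)) (X := ℝ)
  have cp := continuous_const (y := p) (X := ℝ)
  refine ContinuousOn.sub (ContinuousOn.div (cp.mul hH).continuousOn
    ((cp.mul hH).add ((c1.sub cp).mul hL)).continuousOn fun x hx => ?_)
    (ContinuousOn.div (cp.mul (c1.sub hH)).continuousOn
    ((cp.mul (c1.sub hH)).add ((c1.sub cp).mul (c1.sub hL))).continuousOn fun x hx => ?_)
  · have := Experiment.dist_pos s hx
    have h' := (F .low).dist_nonneg s x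
    exact (posterior_denom_pos hp this.le h' (by linarith)).ne'
  · have := Experiment.dist_lt_one s hx
    have h' := (F .low).dist_le_one s x
    exact (posterior_denom_pos hp (by linarith) (by linarith) (by linarith)).ne'

end gap

lemma LowNoisier.subset {F : Profile} (hF : LowNoisier F) :
    (F .low).interiorSupport ⊆ (F .high).interiorSupport := fun _ hx =>
  ⟨hF.lo_lt.trans hx.1, hx.2.trans hF.hi_lt⟩

/-- The hazard-rate conditions make the reputation after report `0` decrease, and that after
report `1` increase, in the cutoff. -/
lemma LowNoisier.strictAntiOn_reputationGap {p : ℝ} {F : Profile} (hF : LowNoisier F)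
    (hp : p ∈ Ioo (0 : ℝ) 1) (s : State) :
    StrictAntiOn (reputationGap p F s) (F .low).interiorSupport := by
  have hconv : Convex ℝ _ := (F .low).ordConnected_interiorSupport.convex
  have hH := (F .high).continuous_dist s
  have hL := (F .low).continuous_dist s
  have pos : ∀ {x}, x ∈ (F .low).interiorSupport → 0 < (F .high).dist s x ∧
      0 < (F .low).dist s x ∧ (F .high).dist s x < 1 ∧ (F .low).dist s x < 1 := fun hx =>
    ⟨Experiment.dist_pos s (hF.subset hx), Experiment.dist_pos s hx,
      Experiment.dist_lt_one s (hF.subset hx), Experiment.dist_lt_one s hx⟩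
  have m1 : StrictMonoOn (fun x => (F .low).dist s x / (F .high).dist s x)
      (F .low).interiorSupport := by
    refine strictMonoOn_of_deriv_pos hconv
      (hL.continuousOn.div hH.continuousOn fun x hx => (pos hx).1.ne') fun x hx => ?_
    have hx := interior_subset hx
    obtain ⟨h1, h2, h3, h4⟩ := pos hx
    rw [((Experiment.hasDerivAt_dist s hx).fun_div
      (Experiment.hasDerivAt_dist s (hF.subset hx)) h1.ne').deriv]
    have := hF.reverse_hazard s x hx.1 hx.2
    change _ / (F .high).dist s x < _ / (F .low).dist s x at this
    rw [div_lt_div_iff₀ h1 h2] at this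
    exact div_pos (by linarith) (by positivity)
  have m2 : StrictAntiOn (fun x => (1 - (F .low).dist s x) / (1 - (F .high).dist s x))
      (F .low).interiorSupport := by
    refine strictAntiOn_of_deriv_neg hconv ((continuous_const.sub hL).continuousOn.div
      (continuous_const.sub hH).continuousOn fun x hx => (sub_pos.2 (pos hx).2.2.1).ne')
      fun x hx => ?_
    have hx := interior_subset hx
    obtain ⟨h1, h2, h3, h4⟩ := pos hx
    rw [(((Experiment.hasDerivAt_dist s hx).const_sub 1).fun_div
      ((Experiment.hasDerivAt_dist s (hF.subset hx)).const_sub 1) (sub_pos.2 h3).ne').deriv]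
    have := hF.hazard s x hx.1 hx.2
    change _ / (1 - (F .high).dist s x) < _ / (1 - (F .low).dist s x) at this
    rw [div_lt_div_iff₀ (sub_pos.2 h3) (sub_pos.2 h4)] at this
    exact div_neg_of_neg_of_pos (by linarith) (pow_pos (sub_pos.2 h3) 2)
  intro x hx y hy hxy
  obtain ⟨a1, a2, a3, a4⟩ := pos hx
  obtain ⟨b1, b2, b3, b4⟩ := pos hy
  have k1 := m1 hx hy hxy
  have k2 := m2 hx hy hxy
  simp only at k1 k2
  rw [div_lt_div_iff₀ a1 b1] at k1
  rw [div_lt_div_iff₀ (sub_pos.2 b3) (sub_pos.2 a3)] at k2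
  refine sub_lt_sub (posterior_lt_posterior hp a1.le a2.le (by linarith) b1.le b2.le
    (by linarith) (by linarith)) (posterior_lt_posterior hp ?_ ?_ ?_ ?_ ?_ ?_ ?_) <;> linarith

/-! ### Crossing points -/

/-- The likelihood ratio `c` at which the crossing belief in state `s` is attained; it does not
depend on the prior. -/
structure IsCrossingRatio (F : Profile) (s : State) (c : ℝ) : Prop where
  mem : c ∈ (F .low).interiorSupport
  pos : ∀ x ∈ (F .high).interiorSupport, x < c → (F .low).dist s x < (F .high).dist s x
  zero : (F .high).dist s c = (F .low).dist s c
  neg : ∀ x ∈ (F .high).interiorSupport, c < x → (F .high).dist s x < (F .low).dist s x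

lemma IsCrossingBelief.exists_isCrossingRatio {μ : ℝ} {F : Profile} {s : State} {b : ℝ}
    (h : IsCrossingBelief μ F s b) (hμ : μ ∈ Ioo (0 : ℝ) 1) :
    ∃ c > 0, b = stateBelief μ (ENNReal.ofReal c) ∧ IsCrossingRatio F s c := by
  have hb : b ∈ Ioo (0 : ℝ) 1 := ⟨(stateBelief_mem_Icc hμ _).1.trans_lt h.mem.1,
    h.mem.2.trans_le (stateBelief_mem_Icc hμ _).2⟩
  obtain ⟨c, hc, rfl⟩ := exists_ratio_eq hμ hb
  have hm := strictMono_stateBelief hμ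
  have hx : ∀ x ∈ (F .high).interiorSupport, stateBelief μ (ENNReal.ofReal x) ∈
      Ioo (stateBelief μ (F .high).lo) (stateBelief μ (F .high).hi) := fun x hx =>
    ⟨hm hx.1, hm hx.2⟩
  refine ⟨c, hc, rfl, ⟨hm.lt_iff_lt.1 h.mem.1, hm.lt_iff_lt.1 h.mem.2⟩, fun x hx' hxc => ?_, ?_,
    fun x hx' hxc => ?_⟩
  · have hx0 := Experiment.pos_of_mem hx'
    have := h.pos _ (hx x hx') (hm ((ENNReal.ofReal_lt_ofReal_iff hc).2 hxc))
    rwa [beliefCdf_stateBelief hμ hx0, beliefCdf_stateBelief hμ hx0] at this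
  · have := h.zero
    rwa [beliefCdf_stateBelief hμ hc, beliefCdf_stateBelief hμ hc] at this
  · have hx0 := Experiment.pos_of_mem hx'
    have := h.neg _ (hx x hx') (hm ((ENNReal.ofReal_lt_ofReal_iff hx0).2 hxc))
    rwa [beliefCdf_stateBelief hμ hx0, beliefCdf_stateBelief hμ hx0] at this

/-- The defining conditions of the class of profiles, with crossing points `c₁ < c₀` expressed as
likelihood ratios. -/
structure HasCrossings (F : Profile) (c₁ c₀ : ℝ) : Prop where
  noisier : LowNoisier F
  one : IsCrossingRatio F 1 c₁
  zero : IsCrossingRatio F 0 c₀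
  lt : c₁ < c₀

lemma exists_hasCrossings {F : Profile} (hF : F ∈ profileClass) :
    ∃ c₁ c₀, HasCrossings F c₁ c₀ := by
  obtain ⟨hN, μ, hμ, b₀, b₁, h0, h1, hlt⟩ := hF
  have hμ' : μ ∈ Ioo (0 : ℝ) 1 := ⟨by linarith [hμ.1], hμ.2⟩
  obtain ⟨c₀, hc0, rfl, k0⟩ := h0.exists_isCrossingRatio hμ'
  obtain ⟨c₁, hc1, rfl, k1⟩ := h1.exists_isCrossingRatio hμ'
  exact ⟨c₁, c₀, hN, k1, k0,
    (ENNReal.ofReal_lt_ofReal_iff hc0).1 ((strictMono_stateBelief hμ').lt_iff_lt.1 hlt)⟩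

/-! ### The equilibrium cutoff -/

/-- `x` is the likelihood-ratio cutoff of an informative equilibrium at the prior `μ`: in each
state the correct report yields the higher reputation, and the sender is indifferent at `x`. -/
structure IsEquilibriumRatio (p : ℝ) (F : Profile) (μ x : ℝ) : Prop where
  mem : x ∈ (F .high).interiorSupport
  neg : reputationGap p F 1 x < 0
  pos : 0 < reputationGap p F 0 x
  indifferent : μ * x * reputationGap p F 1 x + (1 - μ) * reputationGap p F 0 x = 0

namespace HasCrossings

variable {p : ℝ} {F : Profile} {c₁ c₀ : ℝ} (hF : HasCrossings F c₁ c₀) (hp : p ∈ Ioo (0 : ℝ) 1)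

include hF

lemma Icc_subset : Icc c₁ c₀ ⊆ (F .low).interiorSupport :=
  (F .low).ordConnected_interiorSupport.out hF.one.mem hF.zero.mem

lemma subset : (F .low).interiorSupport ⊆ (F .high).interiorSupport := hF.noisier.subset

include hp

lemma gap_one_nonneg {x : ℝ} (hx : x ∈ (F .high).interiorSupport) (h : x ≤ c₁) :
    0 ≤ reputationGap p F 1 x := by
  rcases h.eq_or_lt with rfl | h
  · exact (reputationGap_eq_zero hx hF.one.zero).ge
  · exact (reputationGap_pos hp (hF.one.pos x hx h)).le

lemma gap_zero_nonpos {x : ℝ} (hx : x ∈ (F .high).interiorSupport) (h : c₀ ≤ x) :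
    reputationGap p F 0 x ≤ 0 := by
  rcases h.eq_or_lt with rfl | h
  · exact (reputationGap_eq_zero hx hF.zero.zero).le
  · exact (reputationGap_neg hp (hF.zero.neg x hx h)).le

lemma gap_zero_pos {x : ℝ} (hx : x ∈ (F .high).interiorSupport) (h : x < c₀) :
    0 < reputationGap p F 0 x := reputationGap_pos hp (hF.zero.pos x hx h)

lemma gap_one_neg {x : ℝ} (hx : x ∈ (F .high).interiorSupport) (h : c₁ < x) :
    reputationGap p F 1 x < 0 := reputationGap_neg hp (hF.one.neg x hx h)

lemma mem_Ioo {μ x : ℝ} (hx : IsEquilibriumRatio p F μ x) : x ∈ Ioo c₁ c₀ :=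
  ⟨lt_of_not_ge fun h => (hF.gap_one_nonneg hp hx.mem h).not_gt hx.neg,
    lt_of_not_ge fun h => (hF.gap_zero_nonpos hp hx.mem h).not_gt hx.pos⟩

lemma mem_low {μ x : ℝ} (hx : IsEquilibriumRatio p F μ x) : x ∈ (F .low).interiorSupport :=
  hF.Icc_subset (Ioo_subset_Icc_self (hF.mem_Ioo hp hx))

/-- The indifference condition changes sign between the crossing points. -/
lemma exists_isEquilibriumRatio {μ : ℝ} (hμ : μ ∈ Ioo (0 : ℝ) 1) :
    ∃ x, IsEquilibriumRatio p F μ x := by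
  have hsub := hF.Icc_subset.trans hF.subset
  have hc : ContinuousOn
      (fun x => μ * x * reputationGap p F 1 x + (1 - μ) * reputationGap p F 0 x)
      (Icc c₁ c₀) :=
    ((continuousOn_const.mul continuousOn_id).mul
      ((continuousOn_reputationGap hp 1).mono hsub)).add
      (continuousOn_const.mul ((continuousOn_reputationGap hp 0).mono hsub))
  have m1 := hsub (left_mem_Icc.2 hF.lt.le)
  have m0 := hsub (right_mem_Icc.2 hF.lt.le)
  have h0 := Experiment.pos_of_mem m0
  have e1 := reputationGap_eq_zero (p := p) m1 hF.one.zero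
  have e0 := reputationGap_eq_zero (p := p) m0 hF.zero.zero
  have l1 := hF.gap_zero_pos hp m1 hF.lt
  have l0 := hF.gap_one_neg hp m0 hF.lt
  have hmem : (0 : ℝ) ∈ Ioo (μ * c₀ * reputationGap p F 1 c₀ + (1 - μ) * reputationGap p F 0 c₀)
      (μ * c₁ * reputationGap p F 1 c₁ + (1 - μ) * reputationGap p F 0 c₁) := by
    rw [e0, e1, mul_zero, mul_zero, zero_add, add_zero]
    exact ⟨mul_neg_of_pos_of_neg (mul_pos hμ.1 h0) l0, mul_pos (sub_pos.2 hμ.2) l1⟩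
  obtain ⟨x, hx, h⟩ := intermediate_value_Ioo' hF.lt.le hc hmem
  have hx' := hsub (Ioo_subset_Icc_self hx)
  exact ⟨x, hx', hF.gap_one_neg hp hx' hx.1, hF.gap_zero_pos hp hx' hx.2, h⟩

/-- A larger cutoff rewards report `1` more, so the sender is indifferent there only if state `1`
is less likely. -/
lemma prior_lt_of_ratio_lt {μ μ' x x' : ℝ} (hμ : 0 < μ) (hμ' : μ' < 1)
    (hx : IsEquilibriumRatio p F μ x) (hx' : IsEquilibriumRatio p F μ' x') (h : x < x') :
    μ' < μ := by
  by_contra! hle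
  have a1 := hF.noisier.strictAntiOn_reputationGap hp 1 (hF.mem_low hp hx) (hF.mem_low hp hx') h
  have a0 := hF.noisier.strictAntiOn_reputationGap hp 0 (hF.mem_low hp hx) (hF.mem_low hp hx') h
  have e := hx.indifferent
  have e' := hx'.indifferent
  have hx0 := Experiment.pos_of_mem hx.mem
  have i1 : μ * x < μ' * x' := by nlinarith
  have i2 : μ * x * -reputationGap p F 1 x < μ' * x' * -reputationGap p F 1 x' :=
    mul_lt_mul'' i1 (neg_lt_neg a1) (by positivity) (neg_nonneg.2 hx.neg.le)
  have i3 : (1 - μ') * reputationGap p F 0 x' < (1 - μ) * reputationGap p F 0 x :=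
    mul_lt_mul' (by linarith) a0 hx'.pos.le (by linarith)
  linarith

lemma equilibriumRatio_anti {μ μ' x x' : ℝ} (hμ : 0 < μ) (hμ' : μ' < 1)
    (hx : IsEquilibriumRatio p F μ x) (hx' : IsEquilibriumRatio p F μ' x') (h : μ ≤ μ') :
    x' ≤ x :=
  le_of_not_gt fun hlt => (hF.prior_lt_of_ratio_lt hp hμ hμ' hx hx' hlt).not_ge h

lemma equilibriumRatio_unique {μ x x' : ℝ} (hμ : μ ∈ Ioo (0 : ℝ) 1)
    (hx : IsEquilibriumRatio p F μ x) (hx' : IsEquilibriumRatio p F μ x') : x = x' :=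
  le_antisymm (hF.equilibriumRatio_anti hp hμ.1 hμ.2 hx' hx le_rfl)
    (hF.equilibriumRatio_anti hp hμ.1 hμ.2 hx hx' le_rfl)

/-- At a cutoff where the two reputation gaps cancel, the indifferent belief is `1/2`. -/
lemma exists_gap_sum_eq_zero : ∃ x ∈ Ioo c₁ c₀,
    reputationGap p F 0 x + reputationGap p F 1 x = 0 := by
  have hsub := hF.Icc_subset.trans hF.subset
  have hc : ContinuousOn (fun x => reputationGap p F 0 x + reputationGap p F 1 x)
      (Icc c₁ c₀) :=
    ((continuousOn_reputationGap hp 0).mono hsub).add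
      ((continuousOn_reputationGap hp 1).mono hsub)
  have m1 := hsub (left_mem_Icc.2 hF.lt.le)
  have m0 := hsub (right_mem_Icc.2 hF.lt.le)
  refine intermediate_value_Ioo' hF.lt.le hc ⟨?_, ?_⟩
  · rw [reputationGap_eq_zero m0 hF.zero.zero, zero_add]
    exact hF.gap_one_neg hp m0 hF.lt
  · rw [reputationGap_eq_zero m1 hF.one.zero, add_zero]
    exact hF.gap_zero_pos hp m1 hF.lt

lemma mem_Ioo_of_gap_sum_eq_zero {x : ℝ}
    (h : reputationGap p F 0 x + reputationGap p F 1 x = 0) : x ∈ Ioo c₁ c₀ := by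
  have hp0 := hp.1
  have hx : x ∈ (F .high).interiorSupport := by
    constructor
    · by_contra! hle
      have hH : ∀ s, (F .high).dist s x = 0 := fun s => Experiment.dist_eq_zero s hle
      have hL : ∀ s, (F .low).dist s x = 0 := fun s =>
        Experiment.dist_eq_zero s (hle.trans hF.noisier.lo_lt.le)
      simp only [reputationGap, hH, hL, sub_zero, posterior_self one_pos] at h
      simp [posterior] at h
      linarith
    · by_contra! hle
      have hH : ∀ s, (F .high).dist s x = 1 := fun s => Experiment.dist_eq_one s hle
      have hL : ∀ s, (F .low).dist s x = 1 := fun s =>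
        Experiment.dist_eq_one s (hF.noisier.hi_lt.le.trans hle)
      simp only [reputationGap, hH, hL, sub_self, posterior_self one_pos] at h
      simp [posterior] at h
      linarith
  constructor
  · by_contra! hle
    linarith [hF.gap_one_nonneg hp hx hle, hF.gap_zero_pos hp hx (hle.trans_lt hF.lt)]
  · by_contra! hle
    linarith [hF.gap_zero_nonpos hp hx hle, hF.gap_one_neg hp hx (hF.lt.trans_le hle)]

lemma isEquilibriumRatio_of_gap_sum {x : ℝ}
    (h : reputationGap p F 0 x + reputationGap p F 1 x = 0) :
    IsEquilibriumRatio p F (1 / (1 + x)) x := by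
  have hx := hF.mem_Ioo_of_gap_sum_eq_zero hp h
  have hm := hF.subset (hF.Icc_subset (Ioo_subset_Icc_self hx))
  have h0 := Experiment.pos_of_mem hm
  refine ⟨hm, hF.gap_one_neg hp hm hx.1, hF.gap_zero_pos hp hm hx.2, ?_⟩
  have h1 : 1 - 1 / (1 + x) = 1 / (1 + x) * x := by
    field_simp
    ring
  rw [h1, ← mul_add, add_comm (reputationGap p F 1 x), h, mul_zero]

lemma gap_sum_unique {x y : ℝ} (hx : reputationGap p F 0 x + reputationGap p F 1 x = 0)
    (hy : reputationGap p F 0 y + reputationGap p F 1 y = 0) : x = y := by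
  have mx := hF.Icc_subset (Ioo_subset_Icc_self (hF.mem_Ioo_of_gap_sum_eq_zero hp hx))
  have my := hF.Icc_subset (Ioo_subset_Icc_self (hF.mem_Ioo_of_gap_sum_eq_zero hp hy))
  have hs : StrictAntiOn (fun x => reputationGap p F 0 x + reputationGap p F 1 x)
      (F .low).interiorSupport := fun a ha b hb hab =>
    add_lt_add (hF.noisier.strictAntiOn_reputationGap hp 0 ha hb hab)
      (hF.noisier.strictAntiOn_reputationGap hp 1 ha hb hab)
  exact hs.injOn mx my (hx.trans hy.symm)

/-- With `x₀` the cutoff at which the gaps cancel, the belief at the equilibrium cutoff exceeds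
one half exactly at priors above `1 / (1 + x₀)`. -/
lemma lt_mul_ratio_iff {μ x x₀ : ℝ} (hμ : μ ∈ Ioo (0 : ℝ) 1) (hx : IsEquilibriumRatio p F μ x)
    (h₀ : reputationGap p F 0 x₀ + reputationGap p F 1 x₀ = 0) :
    1 - μ < μ * x ↔ 1 / (1 + x₀) < μ := by
  have hx₀ := hF.isEquilibriumRatio_of_gap_sum hp h₀
  have hp0 := Experiment.pos_of_mem hx₀.mem
  have hν : 1 / (1 + x₀) ∈ Ioo (0 : ℝ) 1 :=
    ⟨by positivity, by rw [div_lt_one (by positivity)]; linarith⟩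
  have anti := hF.noisier.strictAntiOn_reputationGap hp
  have mx := hF.mem_low hp hx
  have mx₀ := hF.mem_low hp hx₀
  have e := hx.indifferent
  have n := hx.neg
  rw [div_lt_iff₀ (by positivity)]
  constructor
  · intro h
    by_contra! hle
    have h' : μ ≤ 1 / (1 + x₀) := (le_div_iff₀ (by positivity)).2 hle
    have hxx := hF.equilibriumRatio_anti hp hμ.1 hν.2 hx hx₀ h'
    have a0 := (anti 0).antitoneOn mx₀ mx hxx
    have a1 := (anti 1).antitoneOn mx₀ mx hxx
    nlinarith [hμ.1, hμ.2]
  · intro h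
    have h' : 1 / (1 + x₀) < μ := (div_lt_iff₀ (by positivity)).2 h
    have hxx := hF.equilibriumRatio_anti hp hν.1 hμ.2 hx₀ hx h'.le
    rcases hxx.eq_or_lt with rfl | hxx
    · linarith
    have a0 := anti 0 mx mx₀ hxx
    have a1 := anti 1 mx mx₀ hxx
    nlinarith [hμ.1, hμ.2]

end HasCrossings

/-! ### The receiver's payoff -/

/-- The probability of report `0` in state `s` if both types use the likelihood-ratio
cutoff `x`. -/
noncomputable def meanDist (p : ℝ) (F : Profile) (s : State) (x : ℝ) : ℝ :=
  p * (F .high).dist s x + (1 - p) * (F .low).dist s x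

/-- The receiver's payoff from following the report, if both types use the cutoff `x`. -/
noncomputable def followPayoff (p : ℝ) (F : Profile) (μ x : ℝ) : ℝ :=
  μ * (1 - meanDist p F 1 x) + (1 - μ) * meanDist p F 0 x

section meanDist

variable {p : ℝ} {F : Profile} (hp : p ∈ Ioo (0 : ℝ) 1)

include hp

lemma meanDist_le_one (s : State) (x : ℝ) : meanDist p F s x ≤ 1 := by
  have h1 := mul_le_mul_of_nonneg_left ((F .high).dist_le_one s x) hp.1.le
  have h2 := mul_le_mul_of_nonneg_left ((F .low).dist_le_one s x) (sub_pos.2 hp.2).le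
  rw [meanDist]
  linarith

lemma meanDist_mono (s : State) : Monotone (meanDist p F s) := fun _ _ h =>
  add_le_add (mul_le_mul_of_nonneg_left ((F .high).dist_mono s h) hp.1.le)
    (mul_le_mul_of_nonneg_left ((F .low).dist_mono s h) (sub_pos.2 hp.2).le)

lemma meanDist_one_le (x : ℝ) : meanDist p F 1 x ≤ meanDist p F 0 x :=
  add_le_add (mul_le_mul_of_nonneg_left ((F .high).dist_one_le x) hp.1.le)
    (mul_le_mul_of_nonneg_left ((F .low).dist_one_le x) (sub_pos.2 hp.2).le)

lemma meanDist_pos {x : ℝ} (s : State) (hx : x ∈ (F .high).interiorSupport) :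
    0 < meanDist p F s x :=
  add_pos_of_pos_of_nonneg (mul_pos hp.1 (Experiment.dist_pos s hx))
    (mul_nonneg (sub_pos.2 hp.2).le ((F .low).dist_nonneg s x))

lemma meanDist_lt_one {x : ℝ} (s : State) (hx : x ∈ (F .high).interiorSupport) :
    meanDist p F s x < 1 := by
  have h1 := mul_lt_mul_of_pos_left (Experiment.dist_lt_one s hx) hp.1
  have h2 := mul_le_mul_of_nonneg_left ((F .low).dist_le_one s x) (sub_pos.2 hp.2).le
  rw [meanDist]
  linarith

lemma meanDist_one_lt {x : ℝ} (hx : x ∈ (F .high).interiorSupport) :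
    meanDist p F 1 x < meanDist p F 0 x :=
  add_lt_add_of_lt_of_le (mul_lt_mul_of_pos_left (Experiment.dist_one_lt hx) hp.1)
    (mul_le_mul_of_nonneg_left ((F .low).dist_one_le x) (sub_pos.2 hp.2).le)

lemma meanDist_one_sub_mem {x y : ℝ} (h : x ≤ y) :
    x * (meanDist p F 0 y - meanDist p F 0 x) ≤ meanDist p F 1 y - meanDist p F 1 x ∧
      meanDist p F 1 y - meanDist p F 1 x ≤ y * (meanDist p F 0 y - meanDist p F 0 x) := by
  obtain ⟨h1, h2⟩ := (F .high).dist_one_sub_mem h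
  obtain ⟨h3, h4⟩ := (F .low).dist_one_sub_mem h
  have hp1 := (sub_pos.2 hp.2).le
  have k1 := mul_le_mul_of_nonneg_left h1 hp.1.le
  have k2 := mul_le_mul_of_nonneg_left h2 hp.1.le
  have k3 := mul_le_mul_of_nonneg_left h3 hp1
  have k4 := mul_le_mul_of_nonneg_left h4 hp1
  simp only [meanDist]
  constructor <;> linarith

/-- Raising the cutoff raises the payoff as long as the belief at the cutoff is below one half. -/
lemma followPayoff_le_of_mul_le {μ x y : ℝ} (hμ : 0 ≤ μ) (h : x ≤ y) (hy : μ * y ≤ 1 - μ) :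
    followPayoff p F μ x ≤ followPayoff p F μ y := by
  have h1 := mul_le_mul_of_nonneg_left (meanDist_one_sub_mem (F := F) hp h).2 hμ
  have h2 := mul_le_mul_of_nonneg_right hy (sub_nonneg.2 (meanDist_mono (F := F) hp 0 h))
  simp only [followPayoff]
  linarith

/-- Lowering the cutoff raises the payoff as long as the belief at the cutoff is above
one half. -/
lemma followPayoff_le_of_le_mul {μ x y : ℝ} (hμ : 0 ≤ μ) (h : x ≤ y) (hx : 1 - μ ≤ μ * x) :
    followPayoff p F μ y ≤ followPayoff p F μ x := by
  have h1 := mul_le_mul_of_nonneg_left (meanDist_one_sub_mem (F := F) hp h).1 hμ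
  have h2 := mul_le_mul_of_nonneg_right hx (sub_nonneg.2 (meanDist_mono (F := F) hp 0 h))
  simp only [followPayoff]
  linarith

/-- Below one half, a belief cutoff makes report `0` credible to the receiver. -/
lemma le_followPayoff {μ x : ℝ} (hμ : 0 ≤ μ) (hx0 : 0 ≤ x) (hx : μ * x ≤ 1 - μ) :
    μ ≤ followPayoff p F μ x := by
  have h := followPayoff_le_of_mul_le (F := F) hp hμ hx0 hx
  have h0 : ∀ s, meanDist p F s 0 = 0 := fun s => by
    simp [meanDist, Experiment.dist_eq_zero s (x := 0)]
  simpa [followPayoff, h0] using h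

end meanDist

lemma receiverPayoff_eq (μ p : ℝ) (F : Profile) (σ : SenderType → Strategy ℝ≥0∞)
    (τ : Strategy State) : receiverPayoff μ p F σ τ = ∑ m,
      (τ.probOne m * (μ * meanReportProb p F σ m 1) +
        (1 - τ.probOne m) * ((1 - μ) * meanReportProb p F σ m 0)) := by
  simp only [receiverPayoff, Fin.sum_univ_two, prior, Strategy.prob, zero_ne_one, if_false,
    if_true]
  ring

/-- The strategy of the receiver that takes action `1` after the reports in `A`, and `0` after the
others. -/
noncomputable def pureStrategy (A : Set State) : Strategy State where
  probOne := A.indicator 1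
  measurable := Measurable.of_discrete
  mem_Icc a := by by_cases h : a ∈ A <;> simp [h]

lemma exists_receiver_optimal (μ p : ℝ) (F : Profile) (σ : SenderType → Strategy ℝ≥0∞) :
    ∃ τ : Strategy State, (∀ τ', receiverPayoff μ p F σ τ' ≤ receiverPayoff μ p F σ τ) ∧
      receiverPayoff μ p F σ τ = ∑ m, max (μ * meanReportProb p F σ m 1)
        ((1 - μ) * meanReportProb p F σ m 0) := by
  let A : Set State := {m | (1 - μ) * meanReportProb p F σ m 0 ≤ μ * meanReportProb p F σ m 1}
  have h : receiverPayoff μ p F σ (pureStrategy A) = ∑ m, max (μ * meanReportProb p F σ m 1)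
        ((1 - μ) * meanReportProb p F σ m 0) := by
    rw [receiverPayoff_eq]
    refine Finset.sum_congr rfl fun m _ => ?_
    by_cases hm : (1 - μ) * meanReportProb p F σ m 0 ≤ μ * meanReportProb p F σ m 1
    · simp [pureStrategy, A, hm]
    · simp [pureStrategy, A, hm, (lt_of_not_ge hm).le]
  refine ⟨pureStrategy A, fun τ' => ?_, h⟩
  rw [h, receiverPayoff_eq]
  refine Finset.sum_le_sum fun m _ => ?_
  obtain ⟨h0, h1⟩ := τ'.mem_Icc m
  have k1 := mul_le_mul_of_nonneg_left (le_max_left (μ * meanReportProb p F σ m 1)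
    ((1 - μ) * meanReportProb p F σ m 0)) h0
  have k2 := mul_le_mul_of_nonneg_left (le_max_right (μ * meanReportProb p F σ m 1)
    ((1 - μ) * meanReportProb p F σ m 0)) (sub_nonneg.2 h1)
  linarith

/-! ### Informative equilibria -/

section equilibrium

variable {μ p x : ℝ} {F : Profile} {σ : SenderType → Strategy ℝ≥0∞} {τ : Strategy State}

lemma meanReportProb_zero (hσ : ∀ t, IsRatioCutoff (F t) (σ t) x) (s : State) :
    meanReportProb p F σ 0 s = meanDist p F s x := by
  simp only [meanReportProb, typeMean, (hσ _).reportProb_zero, meanDist]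

lemma meanReportProb_one (hσ : ∀ t, IsRatioCutoff (F t) (σ t) x) (s : State) :
    meanReportProb p F σ 1 s = 1 - meanDist p F s x := by
  simp only [meanReportProb, typeMean, (hσ _).reportProb_one, meanDist]
  ring

/-- At priors at least one half the receiver always follows report `1`, so that an optimal action
is to follow both reports or to ignore them. -/
lemma receiverPayoff_of_cutoff (hp : p ∈ Ioo (0 : ℝ) 1) (hμ : 1 / 2 ≤ μ) (hμ1 : μ < 1)
    (hσ : ∀ t, IsRatioCutoff (F t) (σ t) x)
    (hτ : ∀ τ', receiverPayoff μ p F σ τ' ≤ receiverPayoff μ p F σ τ) :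
    receiverPayoff μ p F σ τ = max μ (followPayoff p F μ x) := by
  obtain ⟨τ', h1, h2⟩ := exists_receiver_optimal μ p F σ
  rw [le_antisymm (h1 τ) (hτ τ'), h2, Fin.sum_univ_two]
  simp only [meanReportProb_zero hσ, meanReportProb_one hσ]
  have a := meanDist_one_le (F := F) hp x
  have b := meanDist_le_one (F := F) hp 0 x
  have c : (1 - μ) * (1 - meanDist p F 0 x) ≤ μ * (1 - meanDist p F 1 x) :=
    mul_le_mul (by linarith) (by linarith) (by linarith) (by linarith)
  rw [max_eq_left c, max_add, followPayoff]
  congr 1 <;> ring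

/-- Every informative equilibrium uses one cutoff for both types, at which the reputations, given by
Bayes' rule, make the sender indifferent. -/
lemma IsInformativeEquilibrium.exists_ratio {c₁ c₀ : ℝ} (hF : HasCrossings F c₁ c₀)
    (hp : p ∈ Ioo (0 : ℝ) 1) (hμ : μ ∈ Ioo (0 : ℝ) 1) (h : IsInformativeEquilibrium μ p F σ τ) :
    ∃ x, IsEquilibriumRatio p F μ x ∧ ∀ t, IsRatioCutoff (F t) (σ t) x := by
  obtain ⟨r, hE, hI, hB, hA⟩ := h
  have hμ0 := hμ.1
  have hμ1 := sub_pos.2 hμ.2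
  have hA' := sub_pos.2 hA
  have hB' := sub_pos.2 hB
  -- The likelihood ratio at which the gains from correct reports offset each other.
  obtain ⟨x, hx⟩ : ∃ x, x = (1 - μ) * (r 0 0 - r 1 0) / (μ * (r 1 1 - r 0 1)) := ⟨_, rfl⟩
  have hx0 : 0 < x := by rw [hx]; positivity
  have hxe : μ * (r 1 1 - r 0 1) * x = (1 - μ) * (r 0 0 - r 1 0) := by
    rw [hx]
    field_simp
  have hσ : ∀ t, IsRatioCutoff (F t) (σ t) x := fun t =>
    isRatioCutoff_of_optimal hμ0 hA' hx0 hxe (hE.sender_optimal t _)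
  -- A cutoff outside the high type's support would leave a single report.
  have hmem : x ∈ (F .high).interiorSupport := by
    obtain ⟨m, hm, hne⟩ := hI
    rw [Fin.sum_univ_two] at hm hne
    simp only [prior, zero_ne_one, if_false, if_true] at hm hne
    constructor
    · by_contra! hle
      have hG : ∀ s, meanDist p F s x = 0 := fun s => by
        rw [meanDist, Experiment.dist_eq_zero s hle,
          Experiment.dist_eq_zero s (hle.trans hF.noisier.lo_lt.le), mul_zero, mul_zero, add_zero]
      rcases Fin.exists_fin_two.1 ⟨m, rfl⟩ with rfl | rfl
      · simp [meanReportProb_zero hσ, hG] at hm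
      · simp [meanReportProb_one hσ, hG] at hne
    · by_contra! hle
      have hG : ∀ s, meanDist p F s x = 1 := fun s => by
        rw [meanDist, Experiment.dist_eq_one s hle,
          Experiment.dist_eq_one s (hF.noisier.hi_lt.le.trans hle), mul_one, mul_one,
          add_sub_cancel]
      rcases Fin.exists_fin_two.1 ⟨m, rfl⟩ with rfl | rfl
      · simp [meanReportProb_zero hσ, hG] at hne
      · simp [meanReportProb_one hσ, hG] at hm
  have r0 : ∀ s, r 0 s = posterior p ((F .high).dist s x) ((F .low).dist s x) := fun s => by
    have e := meanReportProb_zero (p := p) hσ s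
    rw [hE.bayes 0 s (e ▸ meanDist_pos hp s hmem), e, (hσ _).reportProb_zero]
    rfl
  have r1 : ∀ s, r 1 s = posterior p (1 - (F .high).dist s x) (1 - (F .low).dist s x) :=
    fun s => by
      have e := meanReportProb_one (p := p) hσ s
      rw [hE.bayes 1 s (e ▸ sub_pos.2 (meanDist_lt_one hp s hmem)), meanReportProb, typeMean,
        (hσ _).reportProb_one, (hσ _).reportProb_one]
      rfl
  have g : ∀ s, reputationGap p F s x = r 0 s - r 1 s := fun s => by
    rw [r0, r1, reputationGap]
  refine ⟨x, ⟨hmem, ?_, ?_, ?_⟩, hσ⟩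
  · rw [g]; linarith
  · rw [g]; linarith
  · rw [g, g]; linarith

lemma exists_isInformativeEquilibrium (hp : p ∈ Ioo (0 : ℝ) 1) (hμ : μ ∈ Ioo (0 : ℝ) 1)
    (hx : IsEquilibriumRatio p F μ x) :
    ∃ σ τ, IsInformativeEquilibrium μ p F σ τ := by
  have hx0 := Experiment.pos_of_mem hx.mem
  let σ : SenderType → Strategy ℝ≥0∞ := fun _ => cutoffStrategy x
  have hσ : ∀ t, IsRatioCutoff (F t) (σ t) x := fun t => isRatioCutoff_cutoffStrategy (F t) hx0
  let r : State → State → ℝ := fun m s =>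
    if m = 1 then posterior p (1 - (F .high).dist s x) (1 - (F .low).dist s x)
    else posterior p ((F .high).dist s x) ((F .low).dist s x)
  have g : ∀ s, r 0 s - r 1 s = reputationGap p F s x := fun s => by simp [r, reputationGap]
  have hA : 0 < r 1 1 - r 0 1 := by linarith [g 1, hx.neg]
  have hB : 0 < r 0 0 - r 1 0 := by linarith [g 0, hx.pos]
  obtain ⟨τ, hτ, -⟩ := exists_receiver_optimal μ p F σ
  refine ⟨σ, τ, r, ⟨?_, ?_, ?_, hτ⟩, ⟨0, ?_⟩, sub_pos.1 hB, sub_pos.1 hA⟩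
  · intro m s
    have h1 := (F .high).dist_nonneg s x
    have h2 := (F .high).dist_le_one s x
    have h3 := (F .low).dist_nonneg s x
    have h4 := (F .low).dist_le_one s x
    simp only [r]
    split_ifs
    · exact posterior_mem hp (by linarith) (by linarith)
    · exact posterior_mem hp h1 h3
  · intro m s _
    rcases Fin.exists_fin_two.1 ⟨m, rfl⟩ with rfl | rfl
    · simp only [meanReportProb, typeMean, (hσ _).reportProb_zero]
      rfl
    · simp only [meanReportProb, typeMean, (hσ _).reportProb_one]
      rfl
  · intro t σ'
    refine senderPayoff_le_cutoff (F t) hμ.1 hA hx0 ?_ σ'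
    have e := hx.indifferent
    rw [← g, ← g] at e
    linarith
  · have h0 := meanDist_pos hp 0 hx.mem
    have h1 := meanDist_pos hp 1 hx.mem
    have hlt := meanDist_one_lt hp hx.mem
    have hs : 0 < (1 - μ) * meanDist p F 0 x + μ * meanDist p F 1 x :=
      add_pos (mul_pos (sub_pos.2 hμ.2) h0) (mul_pos hμ.1 h1)
    simp only [Fin.sum_univ_two, prior, zero_ne_one, if_false, if_true, meanReportProb_zero hσ]
    refine ⟨hs, ne_of_lt ?_⟩
    rw [div_lt_iff₀ hs]
    have := mul_pos hμ.1 (mul_pos (sub_pos.2 hμ.2) (sub_pos.2 hlt))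
    linarith

lemma informativePayoffs_eq {c₁ c₀ : ℝ} (hF : HasCrossings F c₁ c₀) (hp : p ∈ Ioo (0 : ℝ) 1)
    (hμ : μ ∈ Ico (1 / 2 : ℝ) 1) (hx : IsEquilibriumRatio p F μ x) :
    informativePayoffs μ p F = {max μ (followPayoff p F μ x)} := by
  have hμ' : μ ∈ Ioo (0 : ℝ) 1 := ⟨by linarith [hμ.1], hμ.2⟩
  have key : ∀ σ τ, IsInformativeEquilibrium μ p F σ τ →
      receiverPayoff μ p F σ τ = max μ (followPayoff p F μ x) := by
    intro σ τ h
    obtain ⟨y, hy, hσ⟩ := h.exists_ratio hF hp hμ'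
    obtain rfl := hF.equilibriumRatio_unique hp hμ' hx hy
    obtain ⟨r, hE, -⟩ := h
    exact receiverPayoff_of_cutoff hp hμ.1 hμ.2 hσ hE.receiver_optimal
  ext u
  constructor
  · rintro ⟨σ, τ, h, rfl⟩
    exact key σ τ h
  · rintro rfl
    obtain ⟨σ, τ, h⟩ := exists_isInformativeEquilibrium hp hμ' hx
    exact ⟨σ, τ, h, (key σ τ h).symm⟩

lemma hasCutoff_of_isRatioCutoff (hμ : μ ∈ Ioo (0 : ℝ) 1)
    (hσ : ∀ t, IsRatioCutoff (F t) (σ t) x) :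
    HasCutoff μ F σ (stateBelief μ (ENNReal.ofReal x)) := by
  have hm := strictMono_stateBelief hμ
  intro t s
  filter_upwards [hσ t s] with ℓ hℓ
  refine ⟨fun h => ?_, fun h => ?_⟩
  · simpa [Strategy.prob] using hℓ.2.1 (hm.lt_iff_lt.1 h)
  · simpa [Strategy.prob] using hℓ.2.2 (hm.lt_iff_lt.1 h)

end equilibrium

/-! ### The prior threshold -/

lemma indifferentAt_half_iff {p y : ℝ} (F : Profile) (hy : y ∈ Ioo (0 : ℝ) 1) :
    IndifferentAt y p F (1 / 2) ↔
      reputationGap p F 0 ((1 - y) / y) + reputationGap p F 1 ((1 - y) / y) = 0 := by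
  have h : ∀ (E : Experiment) s, beliefCdf y E s (1 / 2) = E.dist s ((1 - y) / y) :=
    fun E s => by
      rw [beliefCdf_eq y (by norm_num) hy]
      norm_num
  simp only [IndifferentAt, cutoffReputation, h, typeMean, zero_ne_one, if_false, if_true,
    reputationGap, posterior]
  constructor <;> intro h <;> linarith

lemma HasCrossings.isPriorThreshold_iff {p x₀ : ℝ} {F : Profile} {c₁ c₀ : ℝ}
    (hF : HasCrossings F c₁ c₀) (hp : p ∈ Ioo (0 : ℝ) 1)
    (h₀ : reputationGap p F 0 x₀ + reputationGap p F 1 x₀ = 0) (y : ℝ) :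
    IsPriorThreshold p F y ↔ y = 1 / (1 + x₀) := by
  have hx := hF.isEquilibriumRatio_of_gap_sum hp h₀
  have hx0 := Experiment.pos_of_mem hx.mem
  constructor
  · intro h
    have hy1 : y < 1 := h.lt_bound.trans_le
      (div_le_one_of_le₀ (le_add_of_nonneg_right ENNReal.toReal_nonneg) (by positivity))
    have hy : y ∈ Ioo (0 : ℝ) 1 := ⟨h.pos, hy1⟩
    have hy0 := hy.1.ne'
    rw [hF.gap_sum_unique hp h₀ ((indifferentAt_half_iff F hy).1 h.indifferent)]
    field_simp
    ring
  · rintro rfl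
    have hν : 1 / (1 + x₀) ∈ Ioo (0 : ℝ) 1 :=
      ⟨by positivity, by rw [div_lt_one (by positivity)]; linarith⟩
    refine ⟨hν.1, ?_, ?_, ?_⟩
    · have : (F .high).lo.toReal < x₀ := by
        rw [← ENNReal.toReal_ofReal hx0.le]
        exact (ENNReal.toReal_lt_toReal hx.mem.1.ne_top ENNReal.ofReal_ne_top).2 hx.mem.1
      exact one_div_lt_one_div_of_lt (by positivity) (by linarith)
    · rw [indifferentAt_half_iff F hν]
      convert h₀ using 3 <;> (field_simp; ring)
    · intro μ hμ σ τ h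
      have hμ' : μ ∈ Ioo (0 : ℝ) 1 := ⟨by linarith [hμ.1], hμ.2⟩
      obtain ⟨x, hxe, hσ⟩ := h.exists_ratio hF hp hμ'
      have hxp := Experiment.pos_of_mem hxe.mem
      refine ⟨_, stateBelief_mem hμ' hxp, hasCutoff_of_isRatioCutoff hμ' hσ, ?_⟩
      rw [half_lt_stateBelief_iff hμ' hxp, hF.lt_mul_ratio_iff hp hμ' hxe h₀]

/-! ### The limit of perfect information -/

lemma tendsto_dist_perfectLaw {E : ℕ → Experiment} {s : State}
    (h : Tendsto (fun k => (E k).law s) atTop (𝓝 (perfectLaw s))) {x : ℝ} (hx : 0 < x) :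
    Tendsto (fun k => (E k).dist s x) atTop (𝓝 (if s = 1 then 0 else 1)) := by
  have hx' := ENNReal.ofReal_pos.2 hx
  have hfr : frontier (Iic (ENNReal.ofReal x)) = {ENNReal.ofReal x} :=
    frontier_Iic' ⟨⊤, ENNReal.ofReal_lt_top⟩
  have hne : (if s = 1 then ⊤ else 0 : ℝ≥0∞) ≠ ENNReal.ofReal x := by
    split_ifs
    · exact ENNReal.ofReal_ne_top.symm
    · exact hx'.ne
  have hlaw : (perfectLaw s : Measure ℝ≥0∞) = Measure.dirac (if s = 1 then ⊤ else 0) := rfl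
  have h0 : (perfectLaw s : Measure ℝ≥0∞) (frontier (Iic (ENNReal.ofReal x))) = 0 := by
    rw [hfr, hlaw, Measure.dirac_apply' _ (measurableSet_singleton _),
      indicator_of_notMem (by simpa using hne)]
  have ht := ProbabilityMeasure.tendsto_measure_of_null_frontier_of_tendsto' h h0
  have := (ENNReal.tendsto_toReal (measure_ne_top _ _)).comp ht
  have hv : ((perfectLaw s : Measure ℝ≥0∞) (Iic (ENNReal.ofReal x))).toReal =
      if s = 1 then 0 else 1 := by
    rw [hlaw, Measure.dirac_apply' _ measurableSet_Iic]
    split_ifs <;> simp [indicator]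
  rw [hv] at this
  exact this

/-- The limit, as the high type's information becomes perfect, of the net gain from report `0`
at the likelihood ratio `x` and prior `μ`, given the low type's experiment `L`: a wrong report then
reveals the low type. -/
noncomputable def limitGain (p : ℝ) (L : Experiment) (μ x : ℝ) : ℝ :=
  (1 - μ) * posterior p 1 (L.dist 0 x) - μ * x * posterior p 1 (1 - L.dist 1 x)

section posterior

variable {p : ℝ} (hp : p ∈ Ioo (0 : ℝ) 1)

include hp

lemma tendsto_posterior {h : ℕ → ℝ} {h' l : ℝ} (hh : Tendsto h atTop (𝓝 h')) (h0 : 0 ≤ h')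
    (hl : 0 < l) : Tendsto (fun k => posterior p (h k) l) atTop (𝓝 (posterior p h' l)) :=
  (hh.const_mul p).div ((hh.const_mul p).add_const _)
    (posterior_denom_pos hp h0 hl.le (by linarith)).ne'

lemma continuousAt_limitGain (L : Experiment) (μ x : ℝ) :
    ContinuousAt (limitGain p L μ) x := by
  have hc : ∀ {l : ℝ → ℝ}, Continuous l → (∀ y, 0 ≤ l y) →
      Continuous fun y => posterior p 1 (l y) := fun hl h0 =>
    continuous_const.div (continuous_const.add (continuous_const.mul hl)) fun y =>
      (posterior_denom_pos hp one_pos.le (h0 y) (by linarith [h0 y])).ne'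
  exact ((continuous_const.mul (hc (L.continuous_dist 0) (L.dist_nonneg 0))).sub
    ((continuous_const.mul continuous_id).mul (hc (continuous_const.sub (L.continuous_dist 1))
      fun y => sub_nonneg.2 (L.dist_le_one 1 y)))).continuousAt

lemma posterior_one_lt_iff {l l' : ℝ} (hl : 0 ≤ l) (hl' : 0 ≤ l') :
    posterior p 1 l < posterior p 1 l' ↔ l' < l := by
  rw [posterior, posterior, mul_one, div_lt_div_iff_of_pos_left hp.1
    (by have := mul_nonneg (sub_pos.2 hp.2).le hl; linarith [hp.1])
    (by have := mul_nonneg (sub_pos.2 hp.2).le hl'; linarith [hp.1]), add_lt_add_iff_left,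
    mul_lt_mul_iff_right₀ (sub_pos.2 hp.2)]

end posterior

/-- The point at which the distribution functions in the two states sum to one is the limit of the
cutoffs that correspond to the belief `1/2`. -/
lemma Experiment.exists_dist_add_eq_one (L : Experiment) (hhi : L.hi ≠ ⊤) :
    ∃ x ∈ L.interiorSupport, L.dist 0 x + L.dist 1 x = 1 := by
  have hlo : L.lo ≠ ⊤ := (L.lo_lt_hi.trans_le le_top).ne
  have hle : L.lo.toReal ≤ L.hi.toReal := ENNReal.toReal_mono hhi L.lo_lt_hi.le
  have hm : (1 : ℝ) ∈ Icc (L.dist 0 L.lo.toReal + L.dist 1 L.lo.toReal)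
      (L.dist 0 L.hi.toReal + L.dist 1 L.hi.toReal) := by
    have e0 : ∀ s, L.dist s L.lo.toReal = 0 := fun s =>
      dist_eq_zero s (ENNReal.ofReal_toReal hlo).le
    have e1 : ∀ s, L.dist s L.hi.toReal = 1 := fun s =>
      dist_eq_one s (ENNReal.ofReal_toReal hhi).ge
    simp only [e0, e1]
    norm_num
  obtain ⟨x, -, hx⟩ := intermediate_value_Icc hle
    ((L.continuous_dist 0).add (L.continuous_dist 1)).continuousOn hm
  rw [Pi.add_apply] at hx
  refine ⟨x, ⟨?_, ?_⟩, hx⟩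
  · by_contra! h
    rw [dist_eq_zero 0 h, dist_eq_zero 1 h] at hx
    norm_num at hx
  · by_contra! h
    rw [dist_eq_one 0 h, dist_eq_one 1 h] at hx
    norm_num at hx

namespace HasCrossings

variable {p : ℝ} {F : Profile} {c₁ c₀ : ℝ} (hF : HasCrossings F c₁ c₀) (hp : p ∈ Ioo (0 : ℝ) 1)

include hF hp

/-- A positive net gain from report `0` at `y` puts the equilibrium cutoff above `y`. -/
lemma lt_ratio_of_gain_pos {μ x y : ℝ} (hμ : 0 < μ) (hμ1 : μ < 1)
    (hx : IsEquilibriumRatio p F μ x) (hy : y ∈ (F .low).interiorSupport)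
    (h : 0 < μ * y * reputationGap p F 1 y + (1 - μ) * reputationGap p F 0 y) : y < x := by
  by_contra! hle
  have anti := fun s => (hF.noisier.strictAntiOn_reputationGap hp s).antitoneOn
  have a0 := anti 0 (hF.mem_low hp hx) hy hle
  have a1 := anti 1 (hF.mem_low hp hx) hy hle
  have hy0 := Experiment.pos_of_mem hy
  have k1 := mul_le_mul_of_nonneg_left a1 (mul_pos hμ hy0).le
  have k2 := mul_le_mul_of_nonpos_right (mul_le_mul_of_nonneg_left hle hμ.le) hx.neg.le
  have k0 := mul_le_mul_of_nonneg_left a0 (sub_pos.2 hμ1).le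
  linarith [hx.indifferent]

/-- A negative net gain from report `0` at `y` puts the equilibrium cutoff below `y`. -/
lemma ratio_lt_of_gain_neg {μ x y : ℝ} (hμ : 0 < μ) (hμ1 : μ < 1)
    (hx : IsEquilibriumRatio p F μ x) (hy : y ∈ (F .low).interiorSupport)
    (h : μ * y * reputationGap p F 1 y + (1 - μ) * reputationGap p F 0 y < 0) : x < y := by
  by_contra! hle
  have anti := fun s => (hF.noisier.strictAntiOn_reputationGap hp s).antitoneOn
  have a0 := anti 0 hy (hF.mem_low hp hx) hle
  have a1 := anti 1 hy (hF.mem_low hp hx) hle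
  have hy0 := Experiment.pos_of_mem hy
  have k1 := mul_le_mul_of_nonneg_left a1 (mul_pos hμ hy0).le
  have k2 := mul_le_mul_of_nonpos_right (mul_le_mul_of_nonneg_left hle hμ.le) hx.neg.le
  have k0 := mul_le_mul_of_nonneg_left a0 (sub_pos.2 hμ1).le
  linarith [hx.indifferent]

end HasCrossings

section limit

variable {p : ℝ} {F : ℕ → Profile} {L : Experiment}
  (hlow : ∀ k, F k .low = L)
  (hhigh : ∀ s, Tendsto (fun k => (F k .high).law s) atTop (𝓝 (perfectLaw s)))

include hlow hhigh

lemma tendsto_reputationGap_zero (hp : p ∈ Ioo (0 : ℝ) 1) {x : ℝ}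
    (hx : x ∈ L.interiorSupport) :
    Tendsto (fun k => reputationGap p (F k) 0 x) atTop (𝓝 (posterior p 1 (L.dist 0 x))) := by
  have h := tendsto_dist_perfectLaw (hhigh 0) (Experiment.pos_of_mem hx)
  rw [if_neg zero_ne_one] at h
  have h1 := tendsto_posterior hp h one_pos.le (Experiment.dist_pos 0 hx)
  have h2 := tendsto_posterior hp (h.const_sub 1) (sub_self (1 : ℝ)).ge
    (sub_pos.2 (Experiment.dist_lt_one 0 hx))
  have := h1.sub h2
  simp only [reputationGap, hlow]
  convert this using 2
  simp [posterior]

lemma tendsto_reputationGap_one (hp : p ∈ Ioo (0 : ℝ) 1) {x : ℝ}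
    (hx : x ∈ L.interiorSupport) :
    Tendsto (fun k => reputationGap p (F k) 1 x) atTop
      (𝓝 (-posterior p 1 (1 - L.dist 1 x))) := by
  have h := tendsto_dist_perfectLaw (hhigh 1) (Experiment.pos_of_mem hx)
  rw [if_pos rfl] at h
  have h1 := tendsto_posterior hp h le_rfl (Experiment.dist_pos 1 hx)
  have h2 := tendsto_posterior hp (h.const_sub 1) (by norm_num)
    (sub_pos.2 (Experiment.dist_lt_one 1 hx))
  have := h1.sub h2
  simp only [reputationGap, hlow]
  convert this using 2
  simp [posterior]

lemma tendsto_gain (hp : p ∈ Ioo (0 : ℝ) 1) (μ : ℝ) {x : ℝ} (hx : x ∈ L.interiorSupport) :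
    Tendsto (fun k => μ * x * reputationGap p (F k) 1 x + (1 - μ) * reputationGap p (F k) 0 x)
      atTop (𝓝 (limitGain p L μ x)) := by
  have := ((tendsto_reputationGap_one hlow hhigh hp hx).const_mul (μ * x)).add
    ((tendsto_reputationGap_zero hlow hhigh hp hx).const_mul (1 - μ))
  convert this using 2
  rw [limitGain]
  ring

lemma tendsto_meanDist_add (p : ℝ) {x : ℝ} (hx : 0 < x) :
    Tendsto (fun k => meanDist p (F k) 0 x + meanDist p (F k) 1 x) atTop
      (𝓝 (p + (1 - p) * (L.dist 0 x + L.dist 1 x))) := by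
  have h0 := tendsto_dist_perfectLaw (hhigh 0) hx
  have h1 := tendsto_dist_perfectLaw (hhigh 1) hx
  rw [if_neg zero_ne_one] at h0
  rw [if_pos rfl] at h1
  have := ((h0.const_mul p).add_const ((1 - p) * L.dist 0 x)).add
    ((h1.const_mul p).add_const ((1 - p) * L.dist 1 x))
  simp only [meanDist, hlow]
  convert this using 2
  ring

/-- The cutoffs at which the reputation gaps cancel converge to the point where the low type's
distribution functions sum to one. -/
lemma tendsto_ratio_threshold (hp : p ∈ Ioo (0 : ℝ) 1) {c₁ c₀ z : ℕ → ℝ} {xs : ℝ}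
    (hF : ∀ k, HasCrossings (F k) (c₁ k) (c₀ k))
    (hz : ∀ k, reputationGap p (F k) 0 (z k) + reputationGap p (F k) 1 (z k) = 0)
    (hxs : xs ∈ L.interiorSupport) (hsum : L.dist 0 xs + L.dist 1 xs = 1) :
    Tendsto z atTop (𝓝 xs) := by
  have hmem : ∀ k, z k ∈ (F k .low).interiorSupport := fun k =>
    (hF k).Icc_subset (Ioo_subset_Icc_self ((hF k).mem_Ioo_of_gap_sum_eq_zero hp (hz k)))
  have anti := fun k s => ((hF k).noisier.strictAntiOn_reputationGap hp s).antitoneOn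
  have hnhds := L.isOpen_interiorSupport.mem_nhds hxs
  have hlim : ∀ y ∈ L.interiorSupport, Tendsto
      (fun k => reputationGap p (F k) 0 y + reputationGap p (F k) 1 y) atTop
      (𝓝 (posterior p 1 (L.dist 0 y) + -posterior p 1 (1 - L.dist 1 y))) := fun y hy =>
    (tendsto_reputationGap_zero hlow hhigh hp hy).add
      (tendsto_reputationGap_one hlow hhigh hp hy)
  refine tendsto_order.2 ⟨fun a ha => ?_, fun a ha => ?_⟩
  · have he : ∀ᶠ y in 𝓝[<] xs, y ∈ Ioo a xs := Ioo_mem_nhdsLT ha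
    obtain ⟨y, ⟨hay, hyx⟩, hy⟩ := (he.and (nhdsWithin_le_nhds hnhds)).exists
    have d0 := Experiment.strictMonoOn_dist 0 hy hxs hyx
    have d1 := Experiment.strictMonoOn_dist 1 hy hxs hyx
    have hlt := (posterior_one_lt_iff hp (sub_nonneg.2 (L.dist_le_one 1 y))
      (L.dist_nonneg 0 y)).2 (by linarith)
    filter_upwards [(hlim y hy).eventually (lt_mem_nhds (show (0 : ℝ) < _ by linarith))]
      with k hk
    refine hay.trans (lt_of_not_ge fun hle => ?_)
    have hy' : y ∈ (F k .low).interiorSupport := by rwa [hlow k]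
    linarith [anti k 0 (hmem k) hy' hle, anti k 1 (hmem k) hy' hle, hz k]
  · have he : ∀ᶠ y in 𝓝[>] xs, y ∈ Ioo xs a := Ioo_mem_nhdsGT ha
    obtain ⟨y, ⟨hxy, hya⟩, hy⟩ := (he.and (nhdsWithin_le_nhds hnhds)).exists
    have d0 := Experiment.strictMonoOn_dist 0 hxs hy hxy
    have d1 := Experiment.strictMonoOn_dist 1 hxs hy hxy
    have hlt := (posterior_one_lt_iff hp (L.dist_nonneg 0 y)
      (sub_nonneg.2 (L.dist_le_one 1 y))).2 (by linarith)
    filter_upwards [(hlim y hy).eventually (gt_mem_nhds (show _ < (0 : ℝ) by linarith))]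
      with k hk
    refine (lt_of_not_ge fun hle => ?_ : z k < y).trans hya
    have hy' : y ∈ (F k .low).interiorSupport := by rwa [hlow k]
    linarith [anti k 0 hy' (hmem k) hle, anti k 1 hy' (hmem k) hle, hz k]

/-- Below the limiting threshold (`μ * xs < 1 - μ`), the cutoff stays so high that the probabilities
of report `0` in the two states sum to more than one: the receiver is more often correct in
state `0` than in state `1`. -/
lemma eventually_one_lt_meanDist_add (hp : p ∈ Ioo (0 : ℝ) 1) {c₁ c₀ z : ℕ → ℝ} {μ xs : ℝ}
    (hF : ∀ k, HasCrossings (F k) (c₁ k) (c₀ k)) (hμ : μ ∈ Ioo (0 : ℝ) 1)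
    (hz : ∀ k, IsEquilibriumRatio p (F k) μ (z k))
    (hxs : xs ∈ L.interiorSupport) (hsum : L.dist 0 xs + L.dist 1 xs = 1)
    (hlt : μ * xs < 1 - μ) :
    ∀ᶠ k in atTop, 1 < meanDist p (F k) 0 (z k) + meanDist p (F k) 1 (z k) := by
  have hpos : 0 < limitGain p L μ xs := by
    rw [limitGain, ← eq_sub_of_add_eq hsum, ← sub_mul]
    exact mul_pos (by linarith) (hp.1.trans (lt_posterior hp (L.dist_nonneg 0 xs)
      (Experiment.dist_lt_one 0 hxs)))
  obtain ⟨y, hxy, hy, hgain⟩ := ((eventually_mem_nhdsWithin : ∀ᶠ y in 𝓝[>] xs, y ∈ Ioi xs).and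
    (nhdsWithin_le_nhds ((L.isOpen_interiorSupport.eventually_mem hxs).and
      ((continuousAt_limitGain hp L μ xs).eventually (lt_mem_nhds hpos))))).exists
  have d0 := Experiment.strictMonoOn_dist 0 hxs hy hxy
  have d1 := Experiment.strictMonoOn_dist 1 hxs hy hxy
  have hlim : 1 < p + (1 - p) * (L.dist 0 y + L.dist 1 y) := by
    nlinarith [hp.2]
  filter_upwards [(tendsto_gain hlow hhigh hp μ hy).eventually (lt_mem_nhds hgain),
    (tendsto_meanDist_add hlow hhigh p (Experiment.pos_of_mem hy)).eventually
      (lt_mem_nhds hlim)] with k h1 h2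
  have := (hF k).lt_ratio_of_gain_pos hp hμ.1 hμ.2 (hz k) (by rwa [hlow k]) h1
  linarith [meanDist_mono (F := F k) hp 0 this.le, meanDist_mono (F := F k) hp 1 this.le]

/-- Above the limiting threshold (`1 - μ < μ * xs`), the cutoff stays so low that the probabilities
of report `0` in the two states sum to less than one: the receiver is more often correct in
state `1` than in state `0`. -/
lemma eventually_meanDist_add_lt_one (hp : p ∈ Ioo (0 : ℝ) 1) {c₁ c₀ z : ℕ → ℝ} {μ xs : ℝ}
    (hF : ∀ k, HasCrossings (F k) (c₁ k) (c₀ k)) (hμ : μ ∈ Ioo (0 : ℝ) 1)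
    (hz : ∀ k, IsEquilibriumRatio p (F k) μ (z k))
    (hxs : xs ∈ L.interiorSupport) (hsum : L.dist 0 xs + L.dist 1 xs = 1)
    (hlt : 1 - μ < μ * xs) :
    ∀ᶠ k in atTop, meanDist p (F k) 0 (z k) + meanDist p (F k) 1 (z k) < 1 := by
  have hneg : limitGain p L μ xs < 0 := by
    rw [limitGain, ← eq_sub_of_add_eq hsum, ← sub_mul]
    exact mul_neg_of_neg_of_pos (by linarith) (hp.1.trans (lt_posterior hp
      (L.dist_nonneg 0 xs) (Experiment.dist_lt_one 0 hxs)))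
  obtain ⟨y, hyx, hy, hgain⟩ := ((eventually_mem_nhdsWithin : ∀ᶠ y in 𝓝[<] xs, y ∈ Iio xs).and
    (nhdsWithin_le_nhds ((L.isOpen_interiorSupport.eventually_mem hxs).and
      ((continuousAt_limitGain hp L μ xs).eventually (gt_mem_nhds hneg))))).exists
  have d0 := Experiment.strictMonoOn_dist 0 hy hxs hyx
  have d1 := Experiment.strictMonoOn_dist 1 hy hxs hyx
  have hlim : p + (1 - p) * (L.dist 0 y + L.dist 1 y) < 1 := by
    nlinarith [hp.2]
  filter_upwards [(tendsto_gain hlow hhigh hp μ hy).eventually (gt_mem_nhds hgain),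
    (tendsto_meanDist_add hlow hhigh p (Experiment.pos_of_mem hy)).eventually
      (gt_mem_nhds hlim)] with k h1 h2
  have := (hF k).ratio_lt_of_gain_neg hp hμ.1 hμ.2 (hz k) (by rwa [hlow k]) h1
  linarith [meanDist_mono (F := F k) hp 0 this.le, meanDist_mono (F := F k) hp 1 this.le]

end limit

/-! ### Monotonicity of the receiver's payoff -/

lemma followPayoff_sub (p : ℝ) (F : Profile) (μ μ' x : ℝ) :
    followPayoff p F μ' x - followPayoff p F μ x =
      (μ' - μ) * (1 - (meanDist p F 0 x + meanDist p F 1 x)) := by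
  simp only [followPayoff]
  ring

section monotone

variable {p : ℝ} {F : Profile} {c₁ c₀ μ μ' x x' : ℝ} (hp : p ∈ Ioo (0 : ℝ) 1) (h : μ < μ')

include hp h

/-- If the receiver is more often correct in state `0`, a higher prior lowers the payoff at a fixed
cutoff, and the induced fall of a cutoff that is already too low does no good. -/
lemma payoff_lt_of_low_belief (hμ : 0 < μ) (hx' : 0 ≤ x') (hxx : x' ≤ x)
    (hb : μ * x ≤ 1 - μ) (hb' : μ' * x' ≤ 1 - μ')
    (hG : 1 < meanDist p F 0 x' + meanDist p F 1 x') :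
    max μ' (followPayoff p F μ' x') < max μ (followPayoff p F μ x) := by
  rw [max_eq_right (le_followPayoff hp hμ.le (hx'.trans hxx) hb),
    max_eq_right (le_followPayoff hp (hμ.trans h).le hx' hb')]
  have h1 := followPayoff_le_of_mul_le (F := F) hp hμ.le hxx hb
  have h2 := followPayoff_sub p F μ μ' x'
  have h3 := mul_pos (sub_pos.2 h) (sub_pos.2 hG)
  linarith

/-- If the receiver is more often correct in state `1`, a higher prior raises the payoff at a fixed
cutoff, and the induced fall of a cutoff that is still too high does no harm. -/
lemma payoff_lt_of_high_belief (hμ : 0 < μ) (hxx : x' ≤ x) (hb' : 1 - μ' ≤ μ' * x')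
    (hG : meanDist p F 0 x + meanDist p F 1 x < 1) :
    max μ (followPayoff p F μ x) < max μ' (followPayoff p F μ' x') := by
  have h1 := followPayoff_le_of_le_mul (F := F) hp (hμ.trans h).le hxx hb'
  have h2 := followPayoff_sub p F μ μ' x
  have h3 := mul_pos (sub_pos.2 h) (sub_pos.2 hG)
  exact max_lt_max h (by linarith)

end monotone

end Cheap

theorem mainTheorem2 (p : ℝ) (hp : p ∈ Ioo (0 : ℝ) 1) (F : ℕ → Cheap.Profile)
    (hF : ∀ k, F k ∈ Cheap.profileClass)
    (hlow : ∀ k, F k .low = F 0 .low)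
    (hhigh : ∀ s, Tendsto (fun k => (F k .high).law s) atTop (𝓝 (Cheap.perfectLaw s))) :
    ∃ (muIk : ℕ → ℝ) (muI : ℝ) (U : ℕ → ℝ → ℝ),
      (∀ k x, Cheap.IsPriorThreshold p (F k) x ↔ x = muIk k) ∧
      Tendsto muIk atTop (𝓝 muI) ∧
      (∀ k, ∀ μ ∈ Ico (1 / 2 : ℝ) 1, Cheap.informativePayoffs μ p (F k) = {U k μ}) ∧
      (∀ μ ∈ Ico (1 / 2 : ℝ) muI, ∃ K : ℕ, ∃ ε > 0, ∀ k ≥ K,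
        StrictAntiOn (U k) (Ioo (μ - ε) (μ + ε) ∩ Ico (1 / 2) 1)) ∧
      (∀ μ ∈ Ico (1 / 2 : ℝ) 1, muI < μ → ∃ K : ℕ, ∃ ε > 0, ∀ k ≥ K,
        StrictMonoOn (U k) (Ioo (μ - ε) (μ + ε) ∩ Ico (1 / 2) 1)) := by
  choose c₁ c₀ hC using fun k => Cheap.exists_hasCrossings (hF k)
  choose z _ hz using fun k => (hC k).exists_gap_sum_eq_zero hp
  have hex : ∀ k μ, ∃ x, μ ∈ Ioo (0 : ℝ) 1 → Cheap.IsEquilibriumRatio p (F k) μ x := by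
    intro k μ
    by_cases hμ : μ ∈ Ioo (0 : ℝ) 1
    · obtain ⟨x, hx⟩ := (hC k).exists_isEquilibriumRatio hp hμ
      exact ⟨x, fun _ => hx⟩
    · exact ⟨0, fun h => absurd h hμ⟩
  choose y hy using hex
  obtain ⟨xs, hxs, hsum⟩ := (F 0 .low).exists_dist_add_eq_one
    ((hC 0).noisier.hi_lt.trans_le le_top).ne
  have hxs0 := Cheap.Experiment.pos_of_mem hxs
  have hlim : Tendsto (fun k => 1 / (1 + z k)) atTop (𝓝 (1 / (1 + xs))) :=
    tendsto_const_nhds.div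
      ((Cheap.tendsto_ratio_threshold hlow hhigh hp hC hz hxs hsum).const_add 1) (by positivity)
  have hI0 : 0 < 1 / (1 + xs) := by positivity
  have hI1 : 1 / (1 + xs) < 1 := by rw [div_lt_one (by positivity)]; linarith
  have hhalf : ∀ {μ : ℝ}, μ ∈ Ico (1 / 2 : ℝ) 1 → μ ∈ Ioo (0 : ℝ) 1 := fun h =>
    ⟨by linarith [h.1], h.2⟩
  have hpos : ∀ k {μ}, μ ∈ Ioo (0 : ℝ) 1 → 0 < y k μ := fun k _ hμ =>
    Cheap.Experiment.pos_of_mem (hy k _ hμ).mem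
  refine ⟨fun k => 1 / (1 + z k), 1 / (1 + xs),
    fun k μ => max μ (Cheap.followPayoff p (F k) μ (y k μ)),
    fun k => (hC k).isPriorThreshold_iff hp (hz k), hlim,
    fun k μ hμ => Cheap.informativePayoffs_eq (hC k) hp hμ (hy k μ (hhalf hμ)), ?_, ?_⟩
  · intro μ₀ hμ₀
    -- A prior between `μ₀` and the limiting threshold controls the cutoffs at all priors below it.
    obtain ⟨ν, hν0, hν1⟩ := exists_between hμ₀.2
    have hν : ν ∈ Ioo (0 : ℝ) 1 := ⟨by linarith [hμ₀.1], hν1.trans hI1⟩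
    have hνx : ν * xs < 1 - ν := by
      rw [lt_div_iff₀ (by positivity)] at hν1
      linarith
    obtain ⟨K, hK⟩ := eventually_atTop.1 ((Cheap.eventually_one_lt_meanDist_add hlow hhigh hp hC
      hν (fun k => hy k ν hν) hxs hsum hνx).and (hlim.eventually (lt_mem_nhds hν1)))
    refine ⟨K, ν - μ₀, sub_pos.2 hν0, fun k hk μ hμ μ' hμ' h => ?_⟩
    obtain ⟨hG, hνk⟩ := hK k hk
    have m := hhalf hμ.2
    have m' := hhalf hμ'.2
    have hb : ∀ {a}, a ∈ Ioo (0 : ℝ) 1 → a < ν → a * y k a ≤ 1 - a := fun ha hav =>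
      le_of_not_gt fun hgt => (((hC k).lt_mul_ratio_iff hp ha (hy k _ ha) (hz k)).1 hgt).not_gt
        (hav.trans hνk)
    have hμν : μ' < ν := by linarith [hμ'.1.2]
    have hyy := (hC k).equilibriumRatio_anti hp m'.1 hν.2 (hy k μ' m') (hy k ν hν) hμν.le
    refine Cheap.payoff_lt_of_low_belief hp h m.1 (hpos k m').le
      ((hC k).equilibriumRatio_anti hp m.1 m'.2 (hy k μ m) (hy k μ' m') h.le)
      (hb m (h.trans hμν)) (hb m' hμν) (hG.trans_le ?_)
    exact add_le_add (Cheap.meanDist_mono hp 0 hyy) (Cheap.meanDist_mono hp 1 hyy)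
  · intro μ₀ hμ₀ hlt
    obtain ⟨ν, hν0, hν1⟩ := exists_between hlt
    have hν : ν ∈ Ioo (0 : ℝ) 1 := ⟨hI0.trans hν0, hν1.trans hμ₀.2⟩
    have hνx : 1 - ν < ν * xs := by
      rw [div_lt_iff₀ (by positivity)] at hν0
      linarith
    obtain ⟨K, hK⟩ := eventually_atTop.1 ((Cheap.eventually_meanDist_add_lt_one hlow hhigh hp hC
      hν (fun k => hy k ν hν) hxs hsum hνx).and (hlim.eventually (gt_mem_nhds hν0)))
    refine ⟨K, μ₀ - ν, sub_pos.2 hν1, fun k hk μ hμ μ' hμ' h => ?_⟩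
    obtain ⟨hG, hνk⟩ := hK k hk
    have m := hhalf hμ.2
    have m' := hhalf hμ'.2
    have hμν : ν < μ := by linarith [hμ.1.1]
    have hyy := (hC k).equilibriumRatio_anti hp hν.1 m.2 (hy k ν hν) (hy k μ m) hμν.le
    refine Cheap.payoff_lt_of_high_belief hp h m.1
      ((hC k).equilibriumRatio_anti hp m.1 m'.2 (hy k μ m) (hy k μ' m') h.le)
      (((hC k).lt_mul_ratio_iff hp m' (hy k μ' m') (hz k)).2 ?_).le (lt_of_le_of_lt ?_ hG)
    · exact hνk.trans (hμν.trans h)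
    · exact add_le_add (Cheap.meanDist_mono hp 0 hyy) (Cheap.meanDist_mono hp 1 hyy)
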